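/- **Conventions.** All sets of possible worlds and all carriers of first-order structures are non-empty. A first-order signature $(F,P)=((F_n)_n,(P_n)_n)$ consists of function and predicate symbols of each finite arity (one sort, no equality); homomorphisms of first-order structures commute with the functions and preserve the predicates. The following logics are stratified institutions: each signature $\Sigma$ has a set $\mathrm{Sen}(\Sigma)$ of sentences and a category $\mathrm{Mod}(\Sigma)$ of models; each model $M$ has a set $[\![M]\!]$ of states, functorially in $M$; satisfaction $M\models^w\rho$ depends on a state $w\in[\![M]\!]$; signature morphisms act by renaming symbols in sentences and by reducts on models, and $[\![M']\!]\to[\![M]\!]$ is given for each reduct $M$ of $M'$, so that satisfaction is invariant under change of notation. *Kripke logics.* A frame $W=(|W|,(W_i)_{i\in\mathrm{Nom}},(W_\lambda)_{\lambda\in\Lambda})$ has a set $|W|$ of worlds, elements $W_i\in|W|$ and relations $W_\lambda\subseteq|W|^n$ for $\lambda\in\Lambda_n$; the states of a model $(W,M)$ are the worlds. * $\mathrm{MHPL}$: signatures $(\mathrm{Nom},\Lambda,P)$; sentences $S::=p\mid S\wedge S\mid\neg S\mid\langle\lambda\rangle(S,\dots,S)\mid i\text{-sen}\mid @_iS\mid(\exists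 i)S'$, where $p\in P$, $\lambda\in\Lambda_{n+1}$ is applied to $n$ arguments, $i\in\mathrm{Nom}$, and in $(\exists i)S'$ the nominal $i$ is new and $S'$ is a sentence of the signature extended by $i$. A model is a frame $W$ with a map $M:|W|\to 2^P$; homomorphisms are maps of worlds preserving nominals, relations, and truth of the $p\in P$. Satisfaction: $\models^w p$ iff $p\in M^w$; Boolean connectives as usual; $\models^w\langle\lambda\rangle(\rho_1,\dots,\rho_n)$ iff there is $(w,w_1,\dots,w_n)\in W_\lambda$ with $\models^{w_k}\rho_k$ for all $k$; $\models^w i\text{-sen}$ iff $W_i=w$; $\models^w@_i\rho$ iff $\models^{W_i}\rho$; $\models^w(\exists i)\rho$ iff $\models^w\rho$ for some interpretation of $i$. * $\mathrm{MHFOL}$: signatures $(\mathrm{Nom},\Lambda,(F,P))$; the same, with atoms $\pi(t_1,\dots,t_n)$ (evaluated in the structure $M^w$) in place of $p$, and with quantification $(\exists x)S'$ over a new constant $x$. A model is a frame with $(F,P)$-structures $M^w$ ($w\in|W|$) which all have the same carrier and the same interpretations of constants; $(\exists x)$ ranges over the common carrier; a homomorphism is a frame homomorphism $h_0$ with a map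 $h_1$ of carriers that is a homomorphism $M^w\to N^{h_0(w)}$ for all $w$. * $\mathrm{MMPL},\mathrm{MMFOL}$ omit from these the nominals and all hybrid constructs ($i$-sen, $@_i$, $(\exists i)$); $\mathrm{HPL},\mathrm{HFOL}$ have, instead of $\Lambda$, one binary relation with $\Diamond=\langle\lambda\rangle$; $\mathrm{MPL},\mathrm{MFOL}$ do both. * $\mathrm{HHPL}$: signatures $(\mathrm{Nom}^0,\mathrm{Nom}^1,P)$; the sentences are built from $\mathrm{HPL}$-sentences over $(\mathrm{Nom}^0,P)$, as atoms, and $i$-sen ($i\in\mathrm{Nom}^1$) by upper-layer $\wedge,\neg,\Diamond,@_i$ ($i\in\mathrm{Nom}^1$) and $\exists$ over new nominals of either layer. A model is a frame $W^1$ (with nominals $\mathrm{Nom}^1$, one binary relation) with an $\mathrm{HPL}$-model $M^w$ over $(\mathrm{Nom}^0,P)$ for each $w\in|W^1|$, all of these having the same worlds and the same interpretations of the nominals; the states are the $w\in|W^1|$, and an atom $\rho$ holds at $w$ iff $\rho$ holds at all worlds of $M^w$. Homomorphisms are pairs as for $\mathrm{MHFOL}$. *Open first-order logics.* Signatures are $((F,P),X)$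 with $X$ a finite set of variables; models are $(F,P)$-structures $M$; states are the valuations $w\in|M|^X$. $\mathrm{OFOL}$: the sentences are the first-order sentences over $(F\cup X,P)$ built from atoms by $\wedge,\neg,(\exists x)$ (with $x$ a new constant), and $M\models^w\rho$ iff $\rho$ holds in $M$ with $X$ interpreted by $w$. $\mathrm{MOFOL}$ adds $\langle\pi\rangle(S,\dots,S)$ for $\pi\in P_{n+1}$, with $\models^w\langle\pi\rangle(\rho_1,\dots,\rho_n)$ iff there is $(w,w_1,\dots,w_n)\in(M^X)_\pi$ with $\models^{w_k}\rho_k$ for all $k$, where $M^X$ is the power of $M$. $\mathrm{HOFOL}$ adds to $\mathrm{OFOL}$ the sentences $i$-sen, $@_iS$ and $(\exists i)S'$ for constants $i$, read through the interpretation $(M^X)_i\in|M|^X$, the constant valuation with value $M_i$. $\mathrm{HMOFOL}$ has both. Signature morphisms $(\Sigma,X)\to(\Sigma',X')$ are first-order signature morphisms $\Sigma\to\Sigma'$, where $X\subseteq X'$ is required in $\mathrm{OFOL}$ and $X=X'$ in the other three. **Ultraproducts.** For an ultrafilter $U$ on a set $A$ and $\Sigma$-models $(M_a)_{a\in A}$,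 an ultraproduct is a colimit $(\mu_J:M_J\to M_U)_{J\in U}$ in $\mathrm{Mod}(\Sigma)$ of the directed diagram of canonical projections $M_J\to M_{J'}$ ($J\supseteq J'$ in $U$), where $(p_{J,a}:M_J\to M_a)_{a\in J}$ is a direct product. Consider, for a sentence $\rho$ and $w\in[\![M_U]\!]$, the condition (∗) there are $J\in U$ and $k\in[\![M_J]\!]$ with $[\![\mu_J]\!](k)=w$ and $M_a\models^{[\![p_{J,a}]\!](k)}\rho$ for all $a\in J$. The sentence $\rho$ is *preserved by ultraproducts* if (∗) implies $M_U\models^w\rho$, and *preserved by ultrafactors* if $M_U\models^w\rho$ implies (∗), for all $U$, all families, all their ultraproducts and all $w$. **Compactness.** $\mathcal I^\sharp$ (the local institution) has as models the pairs $(M,w)$ with $w\in[\![M]\!]$, and $(M,w)\models\rho$ iff $M\models^w\rho$. $\mathcal I^*$ (the global institution, defined if all the maps $[\![M']\!]\to[\![M]\!]$ for reducts are surjective) has the models of $\mathcal I$, and $M\models\rho$ iff $M\models^w\rho$ for all $w\in[\![M]\!]$. An institution is *m-compact* if, over each signature, a set $E$ of sentences has a model iff each finite subset of $E$ has a model; it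 is *compact* if, whenever $E\models\rho$, already $E_0\models\rho$ for some finite $E_0\subseteq E$. **Theorem.** Let $\mathcal I$ be any of $\mathrm{MPL}$, $\mathrm{MFOL}$, $\mathrm{HPL}$, $\mathrm{HFOL}$, $\mathrm{MMPL}$, $\mathrm{MHPL}$, $\mathrm{MMFOL}$, $\mathrm{MHFOL}$, $\mathrm{HHPL}$, $\mathrm{OFOL}$, $\mathrm{MOFOL}$, $\mathrm{HOFOL}$, $\mathrm{HMOFOL}$. Then all ultraproducts of models exist, and every sentence of $\mathcal I$ is preserved by all ultraproducts and by all ultrafactors. Moreover $\mathcal I^\sharp$ is m-compact and compact, the maps $[\![M']\!]\to[\![M]\!]$ are surjective (so that $\mathcal I^*$ is defined), and $\mathcal I^*$ is m-compact. -/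

import Mathlib

universe u
open CategoryTheory Opposite FirstOrder

namespace Strat

/-! ## Institutions and compactness -/

structure Institution : Type (u + 2) where
  Sign : Type (u + 1)
  [cat : Category.{u} Sign]
  Sen : Sign ⥤ Type u
  Mod : Signᵒᵖ ⥤ Cat.{u, u + 1}
  Sat {S : Sign} : Mod.obj (op S) → Sen.obj S → Prop
  sat_cond {S T : Sign} (φ : S ⟶ T) (M : Mod.obj (op T)) (ρ : Sen.obj S) :
    Sat M (Sen.map φ ρ) ↔ Sat ((Mod.map φ.op).toFunctor.obj M) ρ

attribute [instance] Institution.cat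

namespace Institution

variable (I : Institution.{u})

/-- The class `E^*` of the models of a set `E` of `S`-sentences. -/
def models {S : I.Sign} (E : Set (I.Sen.obj S)) : Set (I.Mod.obj (op S)) :=
  {M | ∀ ρ ∈ E, I.Sat M ρ}

def MCompact : Prop :=
  ∀ (S : I.Sign) (E : Set (I.Sen.obj S)),
    (I.models E).Nonempty ↔ ∀ E₀ ⊆ E, E₀.Finite → (I.models E₀).Nonempty

def Compact : Prop :=
  ∀ (S : I.Sign) (E : Set (I.Sen.obj S)) (ρ : I.Sen.obj S),
    I.models E ⊆ I.models {ρ} → ∃ E₀ ⊆ E, E₀.Finite ∧ I.models E₀ ⊆ I.models {ρ}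

end Institution

/-! ## Stratified institutions -/

/-- A stratified institution. `st S M` is the set of states of the `S`-model `M`, and
`stMap φ` is the component at `φ` of the lax natural transformation from `Mod` to the functor
constantly equal to the category of sets; `stMap_id` and `stMap_comp` are its coherence laws
(heterogeneous equalities, since reducts compose only up to a propositional equality). -/
structure StratInst : Type (u + 2) where
  Sign : Type (u + 1)
  [cat : Category.{u} Sign]
  Sen : Sign ⥤ Type u
  Mod : Signᵒᵖ ⥤ Cat.{u, u + 1}
  st (S : Sign) : Mod.obj (op S) ⥤ Type u
  stMap {S T : Sign} (φ : S ⟶ T) : st T ⟶ (Mod.map φ.op).toFunctor ⋙ st S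
  stMap_id (S : Sign) (M : Mod.obj (op S)) (w : (st S).obj M) :
    HEq ((stMap (𝟙 S)).app M w) w
  stMap_comp {S T R : Sign} (φ : S ⟶ T) (ψ : T ⟶ R) (M : Mod.obj (op R)) (w : (st R).obj M) :
    HEq ((stMap (φ ≫ ψ)).app M w) ((stMap φ).app _ ((stMap ψ).app M w))
  Sat {S : Sign} (M : Mod.obj (op S)) (w : (st S).obj M) (ρ : Sen.obj S) : Prop
  sat_cond {S T : Sign} (φ : S ⟶ T) (M : Mod.obj (op T)) (w : (st T).obj M) (ρ : Sen.obj S) :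
    Sat ((Mod.map φ.op).toFunctor.obj M) ((stMap φ).app M w) ρ ↔ Sat M w (Sen.map φ ρ)

attribute [instance] StratInst.cat

/-! ## Filtered products -/

/-- A choice, for each `J ∈ F`, of a direct product of the family `(M i)` with `i ∈ J`. -/
structure ProductSystem {C : Type (u + 1)} [Category.{u} C] {ι : Type u} (F : Filter ι)
    (M : ι → C) where
  prod (J : {J : Set ι // J ∈ F}) : C
  proj (J : {J : Set ι // J ∈ F}) (i : J.1) : prod J ⟶ M i
  isProd (J : {J : Set ι // J ∈ F}) : Limits.IsLimit (Limits.Fan.mk (prod J) (proj J))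

/-- The directed diagram of the canonical projections between the products over `J ∈ F`. -/
def ProductSystem.diagram {C : Type (u + 1)} [Category.{u} C] {ι : Type u} {F : Filter ι}
    {M : ι → C} (A : ProductSystem F M) : {J : Set ι // J ∈ F}ᵒᵖ ⥤ C where
  obj J := A.prod J.unop
  map {_ J'} f := Limits.Fan.IsLimit.lift (A.isProd J'.unop)
    fun i => A.proj _ ⟨i.1, leOfHom f.unop i.2⟩
  map_id J := Limits.Fan.IsLimit.hom_ext (A.isProd J.unop) _ _ fun i => by
    rw [Limits.Fan.IsLimit.fac, Category.id_comp]; rfl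
  map_comp {J J' J''} f g := Limits.Fan.IsLimit.hom_ext (A.isProd J''.unop) _ _ fun i => by
    rw [Limits.Fan.IsLimit.fac, Category.assoc, Limits.Fan.IsLimit.fac]
    exact (Limits.Fan.IsLimit.fac (A.isProd J'.unop)
      (fun i => A.proj J.unop ⟨i.1, leOfHom f.unop i.2⟩) ⟨i.1, leOfHom g.unop i.2⟩).symm

/-- An `F`-product of the family `M`: a colimit of the diagram of projections. -/
structure FilteredProduct {C : Type (u + 1)} [Category.{u} C] {ι : Type u} (F : Filter ι)
    (M : ι → C) extends ProductSystem F M where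
  cocone : Limits.Cocone toProductSystem.diagram
  isColimit : Limits.IsColimit cocone

namespace StratInst

variable (I : StratInst.{u})

/-- The reduct functor of the local institution. -/
def sharpRed {S T : I.Sign} (φ : S ⟶ T) : (I.st T).Elements ⥤ (I.st S).Elements where
  obj p := ⟨(I.Mod.map φ.op).toFunctor.obj p.1, (I.stMap φ).app p.1 p.2⟩
  map {p q} f := ⟨(I.Mod.map φ.op).toFunctor.map f.1, by
    have := NatTrans.naturality_apply (I.stMap φ) f.1 p.2
    rw [f.2] at this
    exact this.symm⟩

theorem elements_functor_ext {S : I.Sign} {C : Type (u+1)} [Category.{u} C]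
    (F G : C ⥤ (I.st S).Elements) (A B : C ⥤ I.Mod.obj (op S)) (hAB : A = B)
    (hF : ∀ c, (F.obj c).1 = A.obj c) (hG : ∀ c, (G.obj c).1 = B.obj c)
    (hFm : ∀ {c d} (f : c ⟶ d), HEq (F.map f).1 (A.map f))
    (hGm : ∀ {c d} (f : c ⟶ d), HEq (G.map f).1 (B.map f))
    (h2 : ∀ c, HEq (F.obj c).2 (G.obj c).2) : F = G := by
  subst hAB
  have h1 : ∀ c, F.obj c = G.obj c := fun c =>
    Sigma.ext ((hF c).trans (hG c).symm) (h2 c)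
  refine Functor.hext h1 fun c d f => ?_
  have key : ∀ (p p' q q' : (I.st S).Elements) (hp : p = p') (hq : q = q') (a : p ⟶ q)
      (b : p' ⟶ q'), HEq a.1 b.1 → HEq a b := by
    rintro p _ q _ rfl rfl a b h
    exact heq_of_eq (Subtype.ext (eq_of_heq h))
  exact key _ _ _ _ (h1 c) (h1 d) _ _ ((hFm f).trans (hGm f).symm)

/-- The local institution: its models are the pairs `(M, w)` with `w` a state of `M`, i.e. the
objects of the category of elements of the state functor. -/
def sharp : Institution.{u} where
  Sign := I.Sign
  Sen := I.Sen
  Mod :=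
    { obj := fun S => Cat.of (I.st S.unop).Elements
      map := fun φ => (I.sharpRed φ.unop).toCatHom
      map_id := fun S => by
        apply Cat.ext
        refine I.elements_functor_ext _ _ (CategoryOfElements.π _ ⋙ (I.Mod.map (𝟙 S)).toFunctor)
          (CategoryOfElements.π _) ?_ (fun _ => rfl) (fun _ => rfl) (fun _ => HEq.rfl)
          (fun _ => HEq.rfl) (fun p => I.stMap_id _ p.1 p.2)
        rw [I.Mod.map_id]; rfl
      map_comp := fun {R S T} φ ψ => by
        apply Cat.ext
        refine I.elements_functor_ext _ _ (CategoryOfElements.π _ ⋙ (I.Mod.map (φ ≫ ψ)).toFunctor)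
          (CategoryOfElements.π _ ⋙ (I.Mod.map φ).toFunctor ⋙ (I.Mod.map ψ).toFunctor) ?_
          (fun _ => rfl) (fun _ => rfl) (fun _ => HEq.rfl)
          (fun _ => HEq.rfl) (fun p => I.stMap_comp _ _ p.1 p.2)
        rw [I.Mod.map_comp]; rfl }
  Sat p ρ := I.Sat p.1 p.2 ρ
  sat_cond φ p ρ := (I.sat_cond φ p.1 p.2 ρ).symm

/-- The stratification is surjective. -/
def StSurjective : Prop :=
  ∀ {S T : I.Sign} (φ : S ⟶ T) (M : I.Mod.obj (op T)),
    Function.Surjective ((I.stMap φ).app M)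

/-- The global institution. -/
def star (h : I.StSurjective) : Institution.{u} where
  Sign := I.Sign
  Sen := I.Sen
  Mod := I.Mod
  Sat {S} M ρ := ∀ w : (I.st S).obj M, I.Sat M w ρ
  sat_cond {S T} φ M ρ := by
    constructor
    · intro H w
      obtain ⟨w, rfl⟩ := h φ M w
      exact (I.sat_cond φ M w ρ).2 (H w)
    · intro H w
      exact (I.sat_cond φ M w ρ).1 (H _)

/-- Restriction of a stratified institution along a functor into its category of signatures. -/
def pullback {S : Type (u + 1)} [Category.{u} S] (Φ : S ⥤ I.Sign) : StratInst.{u} where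
  Sign := S
  Sen := Φ ⋙ I.Sen
  Mod := Φ.op ⋙ I.Mod
  st s := I.st (Φ.obj s)
  stMap φ := I.stMap (Φ.map φ)
  stMap_id s M w := by
    have : ∀ (f : Φ.obj s ⟶ Φ.obj s), f = 𝟙 _ → HEq ((I.stMap f).app M w) w := by
      rintro _ rfl; exact I.stMap_id _ _ _
    exact this _ (Φ.map_id s)
  stMap_comp {a b c} φ ψ M w := by
    have : ∀ (f : Φ.obj a ⟶ Φ.obj c), f = Φ.map φ ≫ Φ.map ψ → HEq ((I.stMap f).app M w)
        ((I.stMap (Φ.map φ)).app _ ((I.stMap (Φ.map ψ)).app M w)) := by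
      rintro _ rfl; exact I.stMap_comp _ _ _ _
    exact this _ (Φ.map_comp φ ψ)
  Sat M w ρ := I.Sat M w ρ
  sat_cond φ M w ρ := I.sat_cond (Φ.map φ) M w ρ

def HasUltraproducts : Prop :=
  ∀ (S : I.Sign) (ι : Type u) (U : Ultrafilter ι) (M : ι → I.Mod.obj (op S)),
    Nonempty (FilteredProduct (U : Filter ι) M)

/-- There are `J ∈ F` and a state `k` of the product over `J` that is mapped to `w` and whose
projections satisfy `ρ` at all `j ∈ J`. -/
def FactorSat {S : I.Sign} {ι : Type u} {F : Filter ι} {M : ι → I.Mod.obj (op S)}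
    (A : FilteredProduct F M) (w : (I.st S).obj A.cocone.pt) (ρ : I.Sen.obj S) : Prop :=
  ∃ (J : {J : Set ι // J ∈ F}) (k : (I.st S).obj (A.prod J)),
    (I.st S).map (A.cocone.ι.app (op J)) k = w ∧
      ∀ j : J.1, I.Sat (M j) ((I.st S).map (A.proj J j) k) ρ

def PreservedByUltraproducts {S : I.Sign} (ρ : I.Sen.obj S) : Prop :=
  ∀ (ι : Type u) (U : Ultrafilter ι) (M : ι → I.Mod.obj (op S))
    (A : FilteredProduct (U : Filter ι) M) (w : (I.st S).obj A.cocone.pt),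
    I.FactorSat A w ρ → I.Sat A.cocone.pt w ρ

def PreservedByUltrafactors {S : I.Sign} (ρ : I.Sen.obj S) : Prop :=
  ∀ (ι : Type u) (U : Ultrafilter ι) (M : ι → I.Mod.obj (op S))
    (A : FilteredProduct (U : Filter ι) M) (w : (I.st S).obj A.cocone.pt),
    I.Sat A.cocone.pt w ρ → I.FactorSat A w ρ

end StratInst

/-! ## Kripke frames with nominals and polyadic modalities -/

/-- The modality symbols of the mono-modal logics: a single symbol `◇`, read as a binary
accessibility relation. -/
inductive Dia : ℕ → Type u
  | dia : Dia 2

/-- Nominals, and modality symbols `Mdl n` of arity `n` (to be interpreted as `n`-ary relations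
on worlds, so that `l : Mdl (n + 1)` yields an operator with `n` arguments). -/
structure FrameSig : Type (u + 1) where
  Nom : Type u
  Mdl : ℕ → Type u

namespace FrameSig

@[ext]
structure Hom (S T : FrameSig.{u}) where
  nom : S.Nom → T.Nom
  mdl : ∀ {n : ℕ}, S.Mdl n → T.Mdl n

instance : Category FrameSig.{u} where
  Hom S T := Hom S T
  id _ := ⟨id, id⟩
  comp f g := ⟨g.nom ∘ f.nom, g.mdl ∘ f.mdl⟩

end FrameSig

structure Frame (S : FrameSig.{u}) where
  W : Type u
  [ne : Nonempty W]
  nom : S.Nom → W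
  rel : ∀ {n : ℕ}, S.Mdl n → Set (Fin n → W)

namespace Frame

variable {S T : FrameSig.{u}}

@[ext]
structure Hom (M N : Frame S) where
  toFun : M.W → N.W
  map_nom : ∀ i, toFun (M.nom i) = N.nom i
  map_rel : ∀ {n : ℕ} (l : S.Mdl n) (v : Fin n → M.W), v ∈ M.rel l → toFun ∘ v ∈ N.rel l

instance : Category (Frame S) where
  Hom M N := Hom M N
  id _ := ⟨id, fun _ => rfl, fun _ _ h => h⟩
  comp f g := ⟨g.toFun ∘ f.toFun, fun i => by simp [f.map_nom, g.map_nom],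
    fun l v h => g.map_rel l _ (f.map_rel l v h)⟩

def reduct (φ : S ⟶ T) : Frame T ⥤ Frame S where
  obj M := { W := M.W, ne := M.ne, nom := fun i => M.nom (φ.nom i), rel := fun l => M.rel (φ.mdl l) }
  map h := ⟨h.toFun, fun i => h.map_nom (φ.nom i), fun l v hv => h.map_rel (φ.mdl l) v hv⟩

end Frame

/-! ## Propositional Kripke logics -/

/-- Formulas of polyadic modal propositional logic over the frame signature `S` and the set `P`
of propositional variables, with `k` bound nominal variables in scope. The formulas with `k = 0`
are the sentences; a formula with `k` variables is a sentence over `k` additional nominals. The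
hybrid constructors (nominal sentences, `@`, quantification over nominals) are available only when
`hyb = true`. -/
inductive PForm (hyb : Bool) (S : FrameSig.{u}) (P : Type u) : ℕ → Type u
  | atom {k : ℕ} (p : P) : PForm hyb S P k
  | and {k : ℕ} (ρ σ : PForm hyb S P k) : PForm hyb S P k
  | neg {k : ℕ} (ρ : PForm hyb S P k) : PForm hyb S P k
  | poss {k n : ℕ} (l : S.Mdl (n + 1)) (ρ : Fin n → PForm hyb S P k) : PForm hyb S P k
  | nom {k : ℕ} (h : hyb = true) (i : S.Nom ⊕ Fin k) : PForm hyb S P k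
  | sat {k : ℕ} (h : hyb = true) (i : S.Nom ⊕ Fin k) (ρ : PForm hyb S P k) : PForm hyb S P k
  | exNom {k : ℕ} (h : hyb = true) (ρ : PForm hyb S P (k + 1)) : PForm hyb S P k

abbrev PSig : Type (u + 1) := FrameSig.{u} × Type u

/-- Kripke structures `(W, M)`. -/
structure PModel (S : PSig.{u}) where
  frame : Frame S.1
  val : frame.W → Set S.2

namespace PModel

variable {S T : PSig.{u}}

@[ext]
structure Hom (M N : PModel S) where
  frame : M.frame ⟶ N.frame
  map_val : ∀ w, M.val w ⊆ N.val (frame.toFun w)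

instance : Category (PModel S) where
  Hom M N := Hom M N
  id _ := ⟨𝟙 _, fun _ _ h => h⟩
  comp f g := ⟨f.frame ≫ g.frame, fun w _ h => g.map_val _ (f.map_val w h)⟩

def reduct (φ : S ⟶ T) : PModel T ⥤ PModel S where
  obj M := ⟨(Frame.reduct φ.1).obj M.frame, fun w => {p | φ.2 p ∈ M.val w}⟩
  map h := ⟨(Frame.reduct φ.1).map h.frame, fun w _ hp => h.map_val w hp⟩

end PModel

namespace PForm

variable {hyb : Bool}

def map {S T : FrameSig.{u}} {P Q : Type u} (f : S ⟶ T) (g : P → Q) :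
    ∀ {k : ℕ}, PForm hyb S P k → PForm hyb T Q k
  | _, atom p => atom (g p)
  | _, and ρ σ => and (ρ.map f g) (σ.map f g)
  | _, neg ρ => neg (ρ.map f g)
  | _, poss l ρ => poss (f.mdl l) fun i => (ρ i).map f g
  | _, nom h i => nom h (Sum.map f.nom id i)
  | _, sat h i ρ => sat h (Sum.map f.nom id i) (ρ.map f g)
  | _, exNom h ρ => exNom h (ρ.map f g)

theorem map_id {S : FrameSig.{u}} {P : Type u} {k : ℕ} (ρ : PForm hyb S P k) :
    ρ.map (𝟙 S) id = ρ := by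
  have h : ∀ k (i : S.Nom ⊕ Fin k), Sum.map (FrameSig.Hom.nom (𝟙 S)) id i = i := by
    rintro k (i | i) <;> rfl
  induction ρ <;> simp only [map, *] <;> rfl

theorem map_comp {S T R : FrameSig.{u}} {P Q V : Type u} (f : S ⟶ T) (f' : T ⟶ R) (g : P → Q)
    (g' : Q → V) {k : ℕ} (ρ : PForm hyb S P k) :
    ρ.map (f ≫ f') (g' ∘ g) = (ρ.map f g).map f' g' := by
  have h : ∀ k (i : S.Nom ⊕ Fin k), Sum.map (f ≫ f').nom id i
      = Sum.map f'.nom id (Sum.map f.nom id i) := by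
    rintro k (i | i) <;> rfl
  induction ρ <;> simp only [map, *] <;> rfl

/-- Satisfaction at a world `w`, with `v` interpreting the bound nominal variables. -/
def Sat {S : PSig.{u}} (M : PModel S) :
    ∀ {k : ℕ}, PForm hyb S.1 S.2 k → (Fin k → M.frame.W) → M.frame.W → Prop
  | _, atom p, _, w => p ∈ M.val w
  | _, and ρ σ, v, w => Sat M ρ v w ∧ Sat M σ v w
  | _, neg ρ, v, w => ¬ Sat M ρ v w
  | _, poss l ρ, v, w => ∃ u, Fin.cons w u ∈ M.frame.rel l ∧ ∀ i, Sat M (ρ i) v (u i)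
  | _, nom _ i, v, w => Sum.elim M.frame.nom v i = w
  | _, sat _ i ρ, v, _ => Sat M ρ v (Sum.elim M.frame.nom v i)
  | _, exNom _ ρ, v, w => ∃ a, Sat M ρ (Fin.snoc v a) w

theorem sat_map {S T : PSig.{u}} (φ : S ⟶ T) (M : PModel T) {k : ℕ} (ρ : PForm hyb S.1 S.2 k)
    (v : Fin k → M.frame.W) (w : M.frame.W) :
    Sat ((PModel.reduct φ).obj M) ρ v w ↔ Sat M (ρ.map φ.1 φ.2) v w := by
  have h : ∀ k (i : S.1.Nom ⊕ Fin k) (v : Fin k → M.frame.W),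
      Sum.elim M.frame.nom v (Sum.map φ.1.nom id i)
        = Sum.elim ((PModel.reduct φ).obj M).frame.nom v i := by
    rintro k (i | i) v <;> rfl
  induction ρ generalizing w with
  | atom p => exact Iff.rfl
  | and ρ σ h1 h2 => exact and_congr (h1 _ _) (h2 _ _)
  | neg ρ h1 => exact not_congr (h1 _ _)
  | poss l ρ h1 => exact exists_congr fun u => and_congr Iff.rfl (forall_congr' fun i => h1 _ _ _)
  | nom hh i => simp only [map, Sat, h]; rfl
  | sat hh i ρ h1 => simp only [map, Sat, h]; exact h1 _ _
  | exNom hh ρ h1 => exact exists_congr fun a => h1 _ _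

end PForm

/-- Multi-modal propositional logic, hybrid when `hyb = true`. Its signatures are the tuples
(nominals, modalities, propositional variables). -/
def kripkeProp (hyb : Bool) : StratInst.{u} where
  Sign := PSig.{u}
  Sen :=
    { obj := fun S => PForm hyb S.1 S.2 0
      map := fun φ => ↾(PForm.map φ.1 φ.2)
      map_id := fun S => by ext ρ; exact ρ.map_id
      map_comp := fun φ ψ => by ext ρ; exact ρ.map_comp φ.1 ψ.1 φ.2 ψ.2 }
  Mod :=
    { obj := fun S => Cat.of (PModel S.unop)
      map := fun φ => (PModel.reduct φ.unop).toCatHom }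
  st S :=
    { obj := fun M => M.frame.W
      map := fun h => ↾h.frame.toFun }
  stMap φ := { app := fun M => 𝟙 M.frame.W }
  stMap_id _ _ _ := HEq.rfl
  stMap_comp _ _ _ _ := HEq.rfl
  Sat M w ρ := PForm.Sat M ρ Fin.elim0 w
  sat_cond φ M w ρ := PForm.sat_map φ M ρ _ w


/-- A first-order signature (single-sorted): function and predicate symbols of each arity. -/
abbrev FOLSig : Type (u + 1) := FirstOrder.Language.{u, u}

instance : Category FOLSig.{u} where
  Hom L L' := L →ᴸ L'
  id L := FirstOrder.Language.LHom.id L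
  comp f g := g.comp f

/-! ## First-order logic -/

structure IsFOHom {L : FOLSig.{u}} {D E : Type u} (s : L.Structure D) (t : L.Structure E)
    (h : D → E) : Prop where
  map_fun : ∀ {n : ℕ} (f : L.Functions n) (x : Fin n → D), h (s.funMap f x) = t.funMap f (h ∘ x)
  map_rel : ∀ {n : ℕ} (r : L.Relations n) (x : Fin n → D), s.RelMap r x → t.RelMap r (h ∘ x)

theorem IsFOHom.id {L : FOLSig.{u}} {D : Type u} (s : L.Structure D) : IsFOHom s s id :=
  ⟨fun _ _ => rfl, fun _ _ h => h⟩

theorem IsFOHom.comp {L : FOLSig.{u}} {D E G : Type u} {s : L.Structure D}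
    {t : L.Structure E} {r : L.Structure G} {h : D → E} {k : E → G} (hk : IsFOHom t r k)
    (hh : IsFOHom s t h) : IsFOHom s r (k ∘ h) :=
  ⟨fun f x => by simp [hh.map_fun, hk.map_fun, Function.comp_assoc],
    fun p x hx => hk.map_rel p _ (hh.map_rel p x hx)⟩

abbrev reductStr {L L' : FOLSig.{u}} (φ : L ⟶ L') {D : Type u} (s : L'.Structure D) :
    L.Structure D :=
  @FirstOrder.Language.LHom.reduct L L' φ D s

theorem realize_reduct {L L' : FOLSig.{u}} (φ : L ⟶ L') {D : Type u} (s : L'.Structure D)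
    {α : Type*} (t : L.Term α) (v : α → D) :
    @FirstOrder.Language.Term.realize L D (reductStr φ s) α v t
      = @FirstOrder.Language.Term.realize L' D s α v (FirstOrder.Language.LHom.onTerm φ t) := by
  induction t with
  | var => rfl
  | func f ts ih => simp only [FirstOrder.Language.LHom.onTerm, FirstOrder.Language.Term.realize, ih]; rfl

/-! ## First-order Kripke logics -/

/-- Formulas of polyadic modal first-order logic (without equality) with `k` bound nominal variables
and `m` bound first-order variables in scope; the sentences are those with `k = m = 0`. A formula is
a sentence over `k` additional nominals and `m` additional constants. The hybrid
constructors are available only when `hyb = true`. -/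
inductive QForm (hyb : Bool) (S : FrameSig.{u}) (L : FOLSig.{u}) : ℕ → ℕ → Type u
  | atom {k m n : ℕ} (r : L.Relations n) (t : Fin n → L.Term (Fin m)) : QForm hyb S L k m
  | and {k m : ℕ} (ρ σ : QForm hyb S L k m) : QForm hyb S L k m
  | neg {k m : ℕ} (ρ : QForm hyb S L k m) : QForm hyb S L k m
  | ex {k m : ℕ} (ρ : QForm hyb S L k (m + 1)) : QForm hyb S L k m
  | poss {k m n : ℕ} (l : S.Mdl (n + 1)) (ρ : Fin n → QForm hyb S L k m) : QForm hyb S L k m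
  | nom {k m : ℕ} (h : hyb = true) (i : S.Nom ⊕ Fin k) : QForm hyb S L k m
  | sat {k m : ℕ} (h : hyb = true) (i : S.Nom ⊕ Fin k) (ρ : QForm hyb S L k m) : QForm hyb S L k m
  | exNom {k m : ℕ} (h : hyb = true) (ρ : QForm hyb S L (k + 1) m) : QForm hyb S L k m

abbrev QSig : Type (u + 1) := FrameSig.{u} × FOLSig.{u}

/-- First-order Kripke structures: a first-order structure at each world, all on the same carrier
`D` and with the same interpretations of the constants. -/
structure QModel (S : QSig.{u}) where
  frame : Frame S.1
  D : Type u
  [ne : Nonempty D]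
  str : frame.W → S.2.Structure D
  rigid : ∀ (w w' : frame.W) (c : S.2.Functions 0) (x : Fin 0 → D),
    (str w).funMap c x = (str w').funMap c x

namespace QModel

variable {S T : QSig.{u}}

@[ext]
structure Hom (M N : QModel S) where
  frame : M.frame ⟶ N.frame
  toFun : M.D → N.D
  isHom : ∀ w, IsFOHom (M.str w) (N.str (frame.toFun w)) toFun

instance : Category (QModel S) where
  Hom M N := Hom M N
  id _ := ⟨𝟙 _, id, fun _ => IsFOHom.id _⟩
  comp f g := ⟨f.frame ≫ g.frame, g.toFun ∘ f.toFun, fun w => (g.isHom _).comp (f.isHom w)⟩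

def reduct (φ : S ⟶ T) : QModel T ⥤ QModel S where
  obj M :=
    { frame := (Frame.reduct φ.1).obj M.frame
      D := M.D
      ne := M.ne
      str := fun w => reductStr φ.2 (M.str w)
      rigid := fun w w' c x => M.rigid w w' (φ.2.onFunction c) x }
  map h := ⟨(Frame.reduct φ.1).map h.frame, h.toFun,
    fun w => ⟨fun f x => (h.isHom w).map_fun (φ.2.onFunction f) x,
      fun r x => (h.isHom w).map_rel (φ.2.onRelation r) x⟩⟩

end QModel

namespace QForm

variable {hyb : Bool}

def map {S T : FrameSig.{u}} {L L' : FOLSig.{u}} (f : S ⟶ T) (g : L ⟶ L') :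
    ∀ {k m : ℕ}, QForm hyb S L k m → QForm hyb T L' k m
  | _, _, atom r t => atom (g.onRelation r) fun j => g.onTerm (t j)
  | _, _, and ρ σ => and (ρ.map f g) (σ.map f g)
  | _, _, neg ρ => neg (ρ.map f g)
  | _, _, ex ρ => ex (ρ.map f g)
  | _, _, poss l ρ => poss (f.mdl l) fun i => (ρ i).map f g
  | _, _, nom h i => nom h (Sum.map f.nom id i)
  | _, _, sat h i ρ => sat h (Sum.map f.nom id i) (ρ.map f g)
  | _, _, exNom h ρ => exNom h (ρ.map f g)

theorem map_id {S : FrameSig.{u}} {L : FOLSig.{u}} {k m : ℕ} (ρ : QForm hyb S L k m) :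
    ρ.map (𝟙 S) (𝟙 L) = ρ := by
  have h : ∀ k (i : S.Nom ⊕ Fin k), Sum.map (FrameSig.Hom.nom (𝟙 S)) id i = i := by
    rintro k (i | i) <;> rfl
  have h' : ∀ {α : Type} (t : L.Term α), FirstOrder.Language.LHom.onTerm (𝟙 L) t = t :=
    fun t => congrFun FirstOrder.Language.LHom.id_onTerm t
  induction ρ <;> simp only [map, *] <;> rfl

theorem map_comp {S T R : FrameSig.{u}} {L L' L'' : FOLSig.{u}} (f : S ⟶ T) (f' : T ⟶ R)
    (g : L ⟶ L') (g' : L' ⟶ L'') {k m : ℕ} (ρ : QForm hyb S L k m) :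
    ρ.map (f ≫ f') (g ≫ g') = (ρ.map f g).map f' g' := by
  have h : ∀ k (i : S.Nom ⊕ Fin k), Sum.map (f ≫ f').nom id i
      = Sum.map f'.nom id (Sum.map f.nom id i) := by
    rintro k (i | i) <;> rfl
  have h' : ∀ {α : Type} (t : L.Term α), FirstOrder.Language.LHom.onTerm (g ≫ g') t
      = FirstOrder.Language.LHom.onTerm g' (FirstOrder.Language.LHom.onTerm g t) :=
    fun t => congrFun (FirstOrder.Language.LHom.comp_onTerm g' g) t
  induction ρ <;> simp only [map, *] <;> rfl

/-- Satisfaction at a world `w`, with `v` and `x` interpreting the bound nominal and first-order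
variables. -/
def Sat {S : QSig.{u}} (M : QModel S) :
    ∀ {k m : ℕ}, QForm hyb S.1 S.2 k m → (Fin k → M.frame.W) → (Fin m → M.D) → M.frame.W → Prop
  | _, _, atom r t, _, x, w =>
      (M.str w).RelMap r fun j => @FirstOrder.Language.Term.realize S.2 M.D (M.str w) _ x (t j)
  | _, _, and ρ σ, v, x, w => Sat M ρ v x w ∧ Sat M σ v x w
  | _, _, neg ρ, v, x, w => ¬ Sat M ρ v x w
  | _, _, ex ρ, v, x, w => ∃ d, Sat M ρ v (Fin.snoc x d) w
  | _, _, poss l ρ, v, x, w => ∃ u, Fin.cons w u ∈ M.frame.rel l ∧ ∀ i, Sat M (ρ i) v x (u i)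
  | _, _, nom _ i, v, _, w => Sum.elim M.frame.nom v i = w
  | _, _, sat _ i ρ, v, x, _ => Sat M ρ v x (Sum.elim M.frame.nom v i)
  | _, _, exNom _ ρ, v, x, w => ∃ a, Sat M ρ (Fin.snoc v a) x w

theorem sat_map {S T : QSig.{u}} (φ : S ⟶ T) (M : QModel T) {k m : ℕ} (ρ : QForm hyb S.1 S.2 k m)
    (v : Fin k → M.frame.W) (x : Fin m → M.D) (w : M.frame.W) :
    Sat ((QModel.reduct φ).obj M) ρ v x w ↔ Sat M (ρ.map φ.1 φ.2) v x w := by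
  have h : ∀ k (i : S.1.Nom ⊕ Fin k) (v : Fin k → M.frame.W),
      Sum.elim M.frame.nom v (Sum.map φ.1.nom id i)
        = Sum.elim ((QModel.reduct φ).obj M).frame.nom v i := by
    rintro k (i | i) v <;> rfl
  induction ρ generalizing w with
  | atom r t => simp only [map, Sat, ← realize_reduct]; rfl
  | and ρ σ h1 h2 => exact and_congr (h1 _ _ _) (h2 _ _ _)
  | neg ρ h1 => exact not_congr (h1 _ _ _)
  | ex ρ h1 => exact exists_congr fun d => h1 _ _ _
  | poss l ρ h1 =>
    exact exists_congr fun u => and_congr Iff.rfl (forall_congr' fun i => h1 _ _ _ _)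
  | nom hh i => simp only [map, Sat, h]; rfl
  | sat hh i ρ h1 => simp only [map, Sat, h]; exact h1 _ _ _
  | exNom hh ρ h1 => exact exists_congr fun a => h1 _ _ _

end QForm

/-- Multi-modal first-order logic, hybrid when `hyb = true`. Its signatures are the tuples
(nominals, modalities, first-order signature). -/
def kripkeFO (hyb : Bool) : StratInst.{u} where
  Sign := QSig.{u}
  Sen :=
    { obj := fun S => QForm hyb S.1 S.2 0 0
      map := fun φ => ↾(QForm.map φ.1 φ.2)
      map_id := fun S => by ext ρ; exact ρ.map_id
      map_comp := fun φ ψ => by ext ρ; exact ρ.map_comp φ.1 ψ.1 φ.2 ψ.2 }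
  Mod :=
    { obj := fun S => Cat.of (QModel S.unop)
      map := fun φ => (QModel.reduct φ.unop).toCatHom }
  st S :=
    { obj := fun M => M.frame.W
      map := fun h => ↾h.frame.toFun }
  stMap φ := { app := fun M => 𝟙 M.frame.W }
  stMap_id _ _ _ := HEq.rfl
  stMap_comp _ _ _ _ := HEq.rfl
  Sat M w ρ := QForm.Sat M ρ Fin.elim0 Fin.elim0 w
  sat_cond φ M w ρ := QForm.sat_map φ M ρ _ _ w


/-! ## Open first-order logics -/

structure FModel (L : FOLSig.{u}) where
  D : Type u
  [ne : Nonempty D]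
  str : L.Structure D

namespace FModel

variable {L L' : FOLSig.{u}}

@[ext]
structure Hom (M N : FModel L) where
  toFun : M.D → N.D
  isHom : IsFOHom M.str N.str toFun

instance : Category (FModel L) where
  Hom M N := Hom M N
  id _ := ⟨id, IsFOHom.id _⟩
  comp f g := ⟨g.toFun ∘ f.toFun, g.isHom.comp f.isHom⟩

def reduct (φ : L ⟶ L') : FModel L' ⥤ FModel L where
  obj M := { D := M.D, ne := M.ne, str := reductStr φ M.str }
  map h := ⟨h.toFun, fun f x => h.isHom.map_fun (φ.onFunction f) x,
    fun r x => h.isHom.map_rel (φ.onRelation r) x⟩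

/-- The interpretation of `r` in the power `M ^ X`. -/
def powRel (M : FModel L) (X : Type u) {n : ℕ} (r : L.Relations n) : Set (Fin n → X → M.D) :=
  {u | ∀ x, M.str.RelMap r fun j => u j x}

end FModel

/-- Formulas over the first-order signature `L` and the block `X` of variables, with `k` bound
variables in scope. Each bound variable is a fresh constant added to `L`, so it may occur in terms
and also, when `hyb = true`, as a nominal; hence `ex` is both the first-order quantifier and the
quantifier over nominals. With `hyb = modal = false` the formulas with `k = 0` are the first-order
sentences over `L` extended with the constants `X`. -/
inductive OForm (hyb modal : Bool) (L : FOLSig.{u}) (X : Type u) : ℕ → Type u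
  | atom {k n : ℕ} (r : L.Relations n) (t : Fin n → L.Term (X ⊕ Fin k)) : OForm hyb modal L X k
  | and {k : ℕ} (ρ σ : OForm hyb modal L X k) : OForm hyb modal L X k
  | neg {k : ℕ} (ρ : OForm hyb modal L X k) : OForm hyb modal L X k
  | ex {k : ℕ} (ρ : OForm hyb modal L X (k + 1)) : OForm hyb modal L X k
  | poss {k n : ℕ} (h : modal = true) (r : L.Relations (n + 1))
      (ρ : Fin n → OForm hyb modal L X k) : OForm hyb modal L X k
  | nom {k : ℕ} (h : hyb = true) (i : L.Functions 0 ⊕ Fin k) : OForm hyb modal L X k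
  | sat {k : ℕ} (h : hyb = true) (i : L.Functions 0 ⊕ Fin k) (ρ : OForm hyb modal L X k) :
      OForm hyb modal L X k

/-- Signatures `(L, X)` with `X` a finite block of variables, taken from a set `V`. -/
structure OSig (V : Type u) (hyb modal : Bool) : Type (u + 1) where
  lang : FOLSig.{u}
  X : Finset V

namespace OSig

variable {V : Type u} {hyb modal : Bool}

/-- Morphisms `(L, X) → (L', X')` are first-order signature morphisms such that `X ⊆ X'`. In the
presence of modalities or nominals the satisfaction condition fails for a proper inclusion, and
`X = X'` is required. -/
@[ext]
structure Hom (S T : OSig V hyb modal) where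
  lang : S.lang ⟶ T.lang
  sub : S.X ⊆ T.X
  eq : (hyb || modal) = true → S.X = T.X

instance : Category (OSig V hyb modal) where
  Hom S T := Hom S T
  id S := ⟨𝟙 _, subset_rfl, fun _ => rfl⟩
  comp f g := ⟨f.lang ≫ g.lang, f.sub.trans g.sub, fun h => (f.eq h).trans (g.eq h)⟩

def onVar {S T : OSig V hyb modal} (φ : S ⟶ T) (x : S.X) : T.X := ⟨x.1, φ.sub x.2⟩

theorem onVar_surjective {S T : OSig V hyb modal} (φ : S ⟶ T) (h : (hyb || modal) = true) :
    Function.Surjective (onVar φ) :=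
  fun y => ⟨⟨y.1, (φ.eq h).symm ▸ y.2⟩, rfl⟩

end OSig

namespace OForm

variable {hyb modal : Bool}

def map {L L' : FOLSig.{u}} {X Y : Type u} (g : L ⟶ L') (f : X → Y) :
    ∀ {k : ℕ}, OForm hyb modal L X k → OForm hyb modal L' Y k
  | _, atom r t => atom (g.onRelation r) fun j => g.onTerm ((t j).relabel (Sum.map f id))
  | _, and ρ σ => and (ρ.map g f) (σ.map g f)
  | _, neg ρ => neg (ρ.map g f)
  | _, ex ρ => ex (ρ.map g f)
  | _, poss h r ρ => poss h (g.onRelation r) fun i => (ρ i).map g f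
  | _, nom h i => nom h (Sum.map (fun c => g.onFunction c) id i)
  | _, sat h i ρ => sat h (Sum.map (fun c => g.onFunction c) id i) (ρ.map g f)

theorem map_id {L : FOLSig.{u}} {X : Type u} {k : ℕ} (ρ : OForm hyb modal L X k) :
    ρ.map (𝟙 L) id = ρ := by
  have h : ∀ k (i : L.Functions 0 ⊕ Fin k),
      Sum.map (fun c => FirstOrder.Language.LHom.onFunction (𝟙 L) c) id i = i := by
    rintro k (i | i) <;> rfl
  have h' : ∀ {α : Type u} (t : L.Term α), FirstOrder.Language.LHom.onTerm (𝟙 L) t = t :=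
    fun t => congrFun FirstOrder.Language.LHom.id_onTerm t
  induction ρ <;> simp only [map, Sum.map_id_id, FirstOrder.Language.Term.relabel_id, *] <;> rfl

theorem onTerm_relabel {L L' : FOLSig.{u}} (g : L ⟶ L') {α β : Type u} (f : α → β) (t : L.Term α) :
    FirstOrder.Language.LHom.onTerm g (t.relabel f)
      = (FirstOrder.Language.LHom.onTerm g t).relabel f := by
  induction t with
  | var => rfl
  | func F ts ih =>
    simp only [FirstOrder.Language.LHom.onTerm, FirstOrder.Language.Term.relabel, ih]

theorem map_comp {L L' L'' : FOLSig.{u}} {X Y Z : Type u} (g : L ⟶ L') (g' : L' ⟶ L'')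
    (f : X → Y) (f' : Y → Z) {k : ℕ} (ρ : OForm hyb modal L X k) :
    ρ.map (g ≫ g') (f' ∘ f) = (ρ.map g f).map g' f' := by
  have h : ∀ k (i : L.Functions 0 ⊕ Fin k),
      Sum.map (fun c => FirstOrder.Language.LHom.onFunction (g ≫ g') c) id i
        = Sum.map (fun c => g'.onFunction c) id (Sum.map (fun c => g.onFunction c) id i) := by
    rintro k (i | i) <;> rfl
  have h' : ∀ k (t : L.Term (X ⊕ Fin k)),
      FirstOrder.Language.LHom.onTerm (g ≫ g') (t.relabel (Sum.map (f' ∘ f) id))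
      = FirstOrder.Language.LHom.onTerm g' ((FirstOrder.Language.LHom.onTerm g
          (t.relabel (Sum.map f id))).relabel (Sum.map f' id)) := by
    intro k t
    rw [← onTerm_relabel, FirstOrder.Language.Term.relabel_relabel, Sum.map_comp_map]
    exact congrFun (FirstOrder.Language.LHom.comp_onTerm g' g) _
  induction ρ <;> simp only [map, *] <;> rfl

/-- Satisfaction at a state `w`, with `c` interpreting the bound variables. -/
def Sat {L : FOLSig.{u}} {X : Type u} (M : FModel L) :
    ∀ {k : ℕ}, OForm hyb modal L X k → (Fin k → M.D) → (X → M.D) → Prop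
  | _, atom r t, c, w =>
      M.str.RelMap r fun j => @FirstOrder.Language.Term.realize L M.D M.str _ (Sum.elim w c) (t j)
  | _, and ρ σ, c, w => Sat M ρ c w ∧ Sat M σ c w
  | _, neg ρ, c, w => ¬ Sat M ρ c w
  | _, ex ρ, c, w => ∃ d, Sat M ρ (Fin.snoc c d) w
  | _, poss _ r ρ, c, w => ∃ u, Fin.cons w u ∈ M.powRel X r ∧ ∀ i, Sat M (ρ i) c (u i)
  | _, nom _ i, c, w => (fun _ => Sum.elim (fun a => M.str.funMap a Fin.elim0) c i) = w
  | _, sat _ i ρ, c, _ => Sat M ρ c fun _ => Sum.elim (fun a => M.str.funMap a Fin.elim0) c i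

theorem sat_map {V : Type u} {S T : OSig V hyb modal} (φ : S ⟶ T) (M : FModel T.lang) {k : ℕ}
    (ρ : OForm hyb modal S.lang S.X k) (c : Fin k → M.D) (w : T.X → M.D) :
    Sat ((FModel.reduct φ.lang).obj M) ρ c (w ∘ OSig.onVar φ)
      ↔ Sat M (ρ.map φ.lang (OSig.onVar φ)) c w := by
  have h : ∀ k (i : S.lang.Functions 0 ⊕ Fin k) (c : Fin k → M.D),
      Sum.elim (fun a => M.str.funMap a Fin.elim0) c
          (Sum.map (fun c => φ.lang.onFunction c) id i)
        = Sum.elim (fun a => (reductStr φ.lang M.str).funMap a Fin.elim0) c i := by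
    rintro k (i | i) c <;> rfl
  induction ρ generalizing w with
  | atom r t =>
    have : ∀ j, @FirstOrder.Language.Term.realize _ M.D M.str _ (Sum.elim w c)
        (FirstOrder.Language.LHom.onTerm φ.lang ((t j).relabel (Sum.map (OSig.onVar φ) id)))
        = @FirstOrder.Language.Term.realize _ M.D (reductStr φ.lang M.str) _
          (Sum.elim (w ∘ OSig.onVar φ) c) (t j) := by
      intro j
      refine (realize_reduct φ.lang M.str _ _).symm.trans ?_
      refine (@FirstOrder.Language.Term.realize_relabel S.lang M.D (reductStr φ.lang M.str)
        _ _ (t j) _ _).trans ?_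
      rw [Sum.elim_comp_map]
      rfl
    simp only [map, Sat, this]; rfl
  | and ρ σ h1 h2 => exact and_congr (h1 _ _) (h2 _ _)
  | neg ρ h1 => exact not_congr (h1 _ _)
  | ex ρ h1 => exact exists_congr fun d => h1 _ _
  | @poss k n hm r ρ h1 =>
    have hs := OSig.onVar_surjective φ (by simp [hm])
    have hinj : Function.Injective (OSig.onVar φ) := fun a b hab =>
      Subtype.ext (congrArg (fun y : T.X => y.1) hab)
    let e := Equiv.ofBijective _ ⟨hinj, hs⟩
    have hc : ∀ (u : Fin n → T.X → M.D) (x : S.X),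
        (fun j => (Fin.cons (w ∘ OSig.onVar φ) (fun i => u i ∘ OSig.onVar φ) :
          Fin (n + 1) → S.X → M.D) j x)
        = fun j => (Fin.cons w u : Fin (n + 1) → T.X → M.D) j (OSig.onVar φ x) := by
      intro u x; funext j; cases j using Fin.cases <;> rfl
    constructor
    · rintro ⟨u, hu, hu'⟩
      have hue : (fun i => (fun y => u i (e.symm y)) ∘ OSig.onVar φ) = u := by
        funext i x; exact congrArg (u i) (e.symm_apply_apply x)
      refine ⟨fun i y => u i (e.symm y), fun y => ?_, fun i => (h1 _ _ _).1
        ((congrArg (fun u => Sat ((FModel.reduct φ.lang).obj M) (ρ i) c (u i)) hue).mpr (hu' i))⟩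
      obtain ⟨x, rfl⟩ := hs y
      refine (congrArg (M.str.RelMap (φ.lang.onRelation r)) ?_).mp (hu x)
      refine Eq.trans ?_ (hc (fun i y => u i (e.symm y)) x)
      exact congrArg (fun u : Fin n → S.X → M.D =>
        fun j => (Fin.cons (w ∘ OSig.onVar φ) u : Fin (n + 1) → S.X → M.D) j x) hue.symm
    · rintro ⟨u, hu, hu'⟩
      exact ⟨fun i => u i ∘ OSig.onVar φ, fun x =>
        (congrArg (M.str.RelMap (φ.lang.onRelation r)) (hc u x)).mpr (hu _),
        fun i => (h1 _ _ _).2 (hu' i)⟩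
  | nom hh i =>
    have hs := OSig.onVar_surjective φ (by simp [hh])
    simp only [map, Sat, h]
    exact hs.injective_comp_right.eq_iff (a := fun _ => _) (b := w)
  | sat hh i ρ h1 =>
    exact (h1 _ _).trans (Iff.of_eq (congrArg (fun d => Sat M (ρ.map _ _) c fun _ => d)
      (h _ i c).symm))

end OForm

/-- Open first-order logic, with nominals when `hyb = true` and with modalities when
`modal = true`. The states of a model `M` over `(L, X)` are the valuations of `X` in `M`. -/
def openFO (V : Type u) (hyb modal : Bool) : StratInst.{u} where
  Sign := OSig V hyb modal
  Sen :=
    { obj := fun S => OForm hyb modal S.lang S.X 0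
      map := fun φ => ↾(OForm.map φ.lang (OSig.onVar φ))
      map_id := fun S => by ext ρ; exact ρ.map_id
      map_comp := fun φ ψ => by ext ρ; exact ρ.map_comp φ.lang ψ.lang (OSig.onVar φ) (OSig.onVar ψ) }
  Mod :=
    { obj := fun S => Cat.of (FModel S.unop.lang)
      map := fun φ => (FModel.reduct φ.unop.lang).toCatHom }
  st S :=
    { obj := fun M => S.X → M.D
      map := fun h => ↾(fun w => h.toFun ∘ w) }
  stMap φ := { app := fun M => ↾(fun w => w ∘ OSig.onVar φ) }
  stMap_id _ _ _ := HEq.rfl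
  stMap_comp _ _ _ _ := HEq.rfl
  Sat M w ρ := OForm.Sat M ρ Fin.elim0 w
  sat_cond φ M w ρ := OForm.sat_map φ M ρ _ w

/-! ## Double hybridization of propositional logic -/

structure HHSig : Type (u + 1) where
  Nom₀ : Type u
  Nom₁ : Type u
  P : Type u

namespace HHSig

@[ext]
structure Hom (S T : HHSig.{u}) where
  nom₀ : S.Nom₀ → T.Nom₀
  nom₁ : S.Nom₁ → T.Nom₁
  prp : S.P → T.P

instance : Category HHSig.{u} where
  Hom S T := Hom S T
  id _ := ⟨id, id, id⟩
  comp f g := ⟨g.nom₀ ∘ f.nom₀, g.nom₁ ∘ f.nom₁, g.prp ∘ f.prp⟩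

/-- The signature of the lower hybrid propositional logic. -/
def lower : HHSig.{u} ⥤ PSig.{u} where
  obj S := (⟨S.Nom₀, Dia⟩, S.P)
  map f := (⟨f.nom₀, id⟩, ↾f.prp)

/-- The frame signature of the upper layer. -/
def upper : HHSig.{u} ⥤ FrameSig.{u} where
  obj S := ⟨S.Nom₁, Dia⟩
  map f := ⟨f.nom₁, id⟩

end HHSig

/-- Kripke structures (the upper layer, `frame`) of hybrid propositional Kripke structures, all of
which share their set of worlds `W₀` and their interpretations `nom₀` of the lower nominals. -/
structure HHModel (S : HHSig.{u}) where
  frame : Frame (HHSig.upper.obj S)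
  W₀ : Type u
  [ne : Nonempty W₀]
  nom₀ : S.Nom₀ → W₀
  rel₀ : frame.W → ∀ {n : ℕ}, Dia.{u} n → Set (Fin n → W₀)
  val : frame.W → W₀ → Set S.P

namespace HHModel

variable {S T : HHSig.{u}}

/-- The hybrid propositional model at the upper world `w`. -/
def loc (M : HHModel S) (w : M.frame.W) : PModel (HHSig.lower.obj S) where
  frame := { W := M.W₀, ne := M.ne, nom := M.nom₀, rel := M.rel₀ w }
  val := M.val w

@[ext]
structure Hom (M N : HHModel S) where
  frame : M.frame ⟶ N.frame
  toFun : M.W₀ → N.W₀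
  isHom : ∀ w, ∃ h : M.loc w ⟶ N.loc (frame.toFun w), h.frame.toFun = toFun

instance : Category (HHModel S) where
  Hom M N := Hom M N
  id M := ⟨𝟙 _, id, fun w => ⟨𝟙 (M.loc w), rfl⟩⟩
  comp f g := ⟨f.frame ≫ g.frame, g.toFun ∘ f.toFun, fun w => by
    obtain ⟨a, ha⟩ := f.isHom w
    obtain ⟨b, hb⟩ := g.isHom (f.frame.toFun w)
    exact ⟨a ≫ b, by rw [← ha, ← hb]; rfl⟩⟩

def reduct (φ : S ⟶ T) : HHModel T ⥤ HHModel S where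
  obj M :=
    { frame := (Frame.reduct (HHSig.upper.map φ)).obj M.frame
      W₀ := M.W₀
      ne := M.ne
      nom₀ := M.nom₀ ∘ φ.nom₀
      rel₀ := M.rel₀
      val := fun w v => {p | φ.prp p ∈ M.val w v} }
  map h := ⟨(Frame.reduct (HHSig.upper.map φ)).map h.frame, h.toFun, fun w => by
    obtain ⟨a, ha⟩ := h.isHom w
    exact ⟨(PModel.reduct (HHSig.lower.map φ)).map a, ha⟩⟩

end HHModel

/-- Formulas with `j` bound lower nominals and `k` bound upper nominals in scope. The sentences of
the lower logic serve as atoms (`base`); the other constructors belong to the upper layer,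
which has quantifiers over the nominals of both layers. -/
inductive HHForm (S : HHSig.{u}) : ℕ → ℕ → Type u
  | base {j k : ℕ} (ρ : PForm true (HHSig.lower.obj S).1 (HHSig.lower.obj S).2 j) : HHForm S j k
  | and {j k : ℕ} (ρ σ : HHForm S j k) : HHForm S j k
  | neg {j k : ℕ} (ρ : HHForm S j k) : HHForm S j k
  | dia {j k : ℕ} (ρ : HHForm S j k) : HHForm S j k
  | nom {j k : ℕ} (i : S.Nom₁ ⊕ Fin k) : HHForm S j k
  | sat {j k : ℕ} (i : S.Nom₁ ⊕ Fin k) (ρ : HHForm S j k) : HHForm S j k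
  | exNom₁ {j k : ℕ} (ρ : HHForm S j (k + 1)) : HHForm S j k
  | exNom₀ {j k : ℕ} (ρ : HHForm S (j + 1) k) : HHForm S j k

namespace HHForm

def map {S T : HHSig.{u}} (f : S ⟶ T) : ∀ {j k : ℕ}, HHForm S j k → HHForm T j k
  | _, _, base ρ => base (ρ.map (HHSig.lower.map f).1 (HHSig.lower.map f).2)
  | _, _, and ρ σ => and (ρ.map f) (σ.map f)
  | _, _, neg ρ => neg (ρ.map f)
  | _, _, dia ρ => dia (ρ.map f)
  | _, _, nom i => nom (Sum.map f.nom₁ id i)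
  | _, _, sat i ρ => sat (Sum.map f.nom₁ id i) (ρ.map f)
  | _, _, exNom₁ ρ => exNom₁ (ρ.map f)
  | _, _, exNom₀ ρ => exNom₀ (ρ.map f)

theorem map_id {S : HHSig.{u}} {j k : ℕ} (ρ : HHForm S j k) : ρ.map (𝟙 S) = ρ := by
  have h : ∀ k (i : S.Nom₁ ⊕ Fin k), Sum.map (HHSig.Hom.nom₁ (𝟙 S)) id i = i := by
    rintro k (i | i) <;> rfl
  have h' : ∀ j (ρ : PForm true (HHSig.lower.obj S).1 (HHSig.lower.obj S).2 j),
      ρ.map (HHSig.lower.map (𝟙 S)).1 (HHSig.lower.map (𝟙 S)).2 = ρ := fun j ρ => ρ.map_id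
  induction ρ <;> simp only [map, *]

theorem map_comp {S T R : HHSig.{u}} (f : S ⟶ T) (g : T ⟶ R) {j k : ℕ} (ρ : HHForm S j k) :
    ρ.map (f ≫ g) = (ρ.map f).map g := by
  have h : ∀ k (i : S.Nom₁ ⊕ Fin k), Sum.map (f ≫ g).nom₁ id i
      = Sum.map g.nom₁ id (Sum.map f.nom₁ id i) := by
    rintro k (i | i) <;> rfl
  have h' : ∀ j (ρ : PForm true (HHSig.lower.obj S).1 (HHSig.lower.obj S).2 j),
      ρ.map (HHSig.lower.map (f ≫ g)).1 (HHSig.lower.map (f ≫ g)).2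
        = (ρ.map (HHSig.lower.map f).1 (HHSig.lower.map f).2).map (HHSig.lower.map g).1
            (HHSig.lower.map g).2 := fun j ρ =>
    ρ.map_comp (HHSig.lower.map f).1 (HHSig.lower.map g).1 f.prp g.prp
  induction ρ <;> simp only [map, *]

/-- Satisfaction at an upper world `w`. A sentence of the lower logic holds at `w` when it holds
globally, i.e. at every world, in the hybrid propositional model at `w`. -/
def Sat {S : HHSig.{u}} (M : HHModel S) :
    ∀ {j k : ℕ}, HHForm S j k → (Fin j → M.W₀) → (Fin k → M.frame.W) → M.frame.W → Prop
  | _, _, base ρ, x, _, w => ∀ a : M.W₀, PForm.Sat (M.loc w) ρ x a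
  | _, _, and ρ σ, x, v, w => Sat M ρ x v w ∧ Sat M σ x v w
  | _, _, neg ρ, x, v, w => ¬ Sat M ρ x v w
  | _, _, dia ρ, x, v, w => ∃ w', ![w, w'] ∈ M.frame.rel Dia.dia ∧ Sat M ρ x v w'
  | _, _, nom i, _, v, w => Sum.elim M.frame.nom v i = w
  | _, _, sat i ρ, x, v, _ => Sat M ρ x v (Sum.elim M.frame.nom v i)
  | _, _, exNom₁ ρ, x, v, w => ∃ a, Sat M ρ x (Fin.snoc v a) w
  | _, _, exNom₀ ρ, x, v, w => ∃ a, Sat M ρ (Fin.snoc x a) v w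

theorem sat_map {S T : HHSig.{u}} (φ : S ⟶ T) (M : HHModel T) {j k : ℕ} (ρ : HHForm S j k)
    (x : Fin j → M.W₀) (v : Fin k → M.frame.W) (w : M.frame.W) :
    Sat ((HHModel.reduct φ).obj M) ρ x v w ↔ Sat M (ρ.map φ) x v w := by
  have h : ∀ k (i : S.Nom₁ ⊕ Fin k) (v : Fin k → M.frame.W),
      Sum.elim M.frame.nom v (Sum.map φ.nom₁ id i)
        = Sum.elim ((HHModel.reduct φ).obj M).frame.nom v i := by
    rintro k (i | i) v <;> rfl
  induction ρ generalizing w with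
  | base ρ => exact forall_congr' fun a => PForm.sat_map (HHSig.lower.map φ) (M.loc w) ρ x a
  | and ρ σ h1 h2 => exact and_congr (h1 _ _ _) (h2 _ _ _)
  | neg ρ h1 => exact not_congr (h1 _ _ _)
  | dia ρ h1 => exact exists_congr fun u => and_congr Iff.rfl (h1 _ _ _)
  | nom i => exact Iff.of_eq (congrArg (· = w) (h _ i v).symm)
  | sat i ρ h1 =>
    exact (h1 _ _ _).trans (Iff.of_eq (congrArg (Sat M (ρ.map φ) x v) (h _ i v).symm))
  | exNom₁ ρ h1 => exact exists_congr fun a => h1 _ _ _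
  | exNom₀ ρ h1 => exact exists_congr fun a => h1 _ _ _

end HHForm

def hhpl : StratInst.{u} where
  Sign := HHSig.{u}
  Sen :=
    { obj := fun S => HHForm S 0 0
      map := fun φ => ↾(HHForm.map φ)
      map_id := fun S => by ext ρ; exact ρ.map_id
      map_comp := fun φ ψ => by ext ρ; exact ρ.map_comp φ ψ }
  Mod :=
    { obj := fun S => Cat.of (HHModel S.unop)
      map := fun φ => (HHModel.reduct φ.unop).toCatHom }
  st S :=
    { obj := fun M => M.frame.W
      map := fun h => ↾h.frame.toFun }
  stMap φ := { app := fun M => 𝟙 M.frame.W }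
  stMap_id _ _ _ := HEq.rfl
  stMap_comp _ _ _ _ := HEq.rfl
  Sat M w ρ := HHForm.Sat M ρ Fin.elim0 Fin.elim0 w
  sat_cond φ M w ρ := HHForm.sat_map φ M ρ _ _ w

/-! ## The benchmark examples -/

/-- No nominals, a single binary modality. -/
def plainSig : FrameSig.{u} := ⟨PEmpty, Dia⟩

/-- Nominals, a single binary modality. -/
def nomSig : Type u ⥤ FrameSig.{u} where
  obj N := ⟨N, Dia⟩
  map f := ⟨f, id⟩

/-- No nominals, arbitrary modalities. -/
def mdlSig : (ℕ → Type u) ⥤ FrameSig.{u} where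
  obj Λ := ⟨PEmpty, Λ⟩
  map f := ⟨id, fun {n} l => f n l⟩

inductive Benchmark
  | MPL | MFOL | HPL | HFOL | MMPL | MHPL | MMFOL | MHFOL | HHPL | OFOL | MOFOL | HOFOL | HMOFOL

/-- The benchmark stratified institutions. In the last four, `V` is the set from which
the blocks of variables are taken. -/
def Benchmark.inst (V : Type u) : Benchmark → StratInst.{u}
  | MPL => (kripkeProp false).pullback (Prod.sectR plainSig (Type u))
  | HPL => (kripkeProp true).pullback (nomSig.prod (𝟭 (Type u)))
  | MMPL => (kripkeProp false).pullback (mdlSig.prod (𝟭 (Type u)))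
  | MHPL => kripkeProp true
  | MFOL => (kripkeFO false).pullback (Prod.sectR plainSig FOLSig)
  | HFOL => (kripkeFO true).pullback (nomSig.prod (𝟭 FOLSig))
  | MMFOL => (kripkeFO false).pullback (mdlSig.prod (𝟭 FOLSig))
  | MHFOL => kripkeFO true
  | HHPL => hhpl
  | OFOL => openFO V false false
  | MOFOL => openFO V false true
  | HOFOL => openFO V true false
  | HMOFOL => openFO V true true

end Strat

/-! The models of each logic are nonempty many-sorted relational structures, operations being given
by their graphs, and their morphisms are exactly the homomorphisms of these structures. Such a
category has the usual products and, for a filter `F`, the usual reduced products, in which a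
relation holds if it holds at `F`-almost all indices. The reduced product is the colimit of the
products over the sets in `F`; as colimits are unique up to isomorphism, every ultraproduct in the
categorical sense is of this form, and its states are the classes of the families of states of the
factors.

Łoś's theorem, that a sentence holds at the class of a family of states if and only if it holds at
almost all members of the family, then follows by induction on sentences: an ultrafilter commutes
with negation, and any filter commutes with an existential quantifier by choice of witnesses. It
gives preservation by ultraproducts and ultrafactors at once, and compactness by taking an
ultraproduct, over the finite subsets of a set of sentences, of models of these subsets.
-/

namespace Strat

/-! ## Reduced products of sets -/

/-- `q` exhibits `Y` as the reduced product of the family `X` modulo the filter `F`: an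
ultraproduct when `F` is an ultrafilter. -/
structure IsReducedProduct {ι : Type u} (F : Filter ι) {X : ι → Type u} {Y : Type u}
    (q : (∀ i, X i) → Y) : Prop where
  surjective : Function.Surjective q
  eq_iff : ∀ k k', q k = q k' ↔ ∀ᶠ i in F, k i = k' i

/-- The map induced by `q` on `κ`-indexed tuples. -/
def tuple {ι : Type u} {X : ι → Type u} {Y : Type u} (q : (∀ i, X i) → Y) {κ : Type*}
    (k : ∀ i, κ → X i) : κ → Y :=
  fun c => q fun i => k i c

section tuple

variable {ι : Type u} {X : ι → Type u} {Y : Type u} (q : (∀ i, X i) → Y)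

theorem tuple_surjective {q : (∀ i, X i) → Y} (hq : Function.Surjective q) (κ : Type*) :
    Function.Surjective (tuple q (κ := κ)) := fun y => by
  choose k hk using fun c => hq (y c)
  exact ⟨fun i c => k c i, funext hk⟩

theorem tuple_snoc {n : ℕ} (k : ∀ i, Fin n → X i) (a : ∀ i, X i) :
    (Fin.snoc (tuple q k) (q a) : Fin (n + 1) → Y)
      = tuple q fun i => (Fin.snoc (k i) (a i) : Fin (n + 1) → X i) := by
  funext c
  cases c using Fin.lastCases <;> simp [tuple]

theorem tuple_cons {n : ℕ} (k : ∀ i, Fin n → X i) (a : ∀ i, X i) :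
    (Fin.cons (q a) (tuple q k) : Fin (n + 1) → Y)
      = tuple q fun i => (Fin.cons (a i) (k i) : Fin (n + 1) → X i) := by
  funext c
  cases c using Fin.cases <;> simp [tuple]

theorem tuple_pair (k k' : ∀ i, X i) : ![q k, q k'] = tuple q fun i => ![k i, k' i] := by
  funext c
  fin_cases c <;> rfl

theorem tuple_sumElim {α β : Type*} (k : ∀ i, α → X i) (k' : ∀ i, β → X i) :
    Sum.elim (tuple q k) (tuple q k') = tuple q fun i => Sum.elim (k i) (k' i) := by
  funext c
  cases c <;> rfl

theorem tuple_elim0 (k : ∀ i, Fin 0 → X i) : tuple q k = Fin.elim0 := funext fun c => c.elim0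

end tuple

theorem exists_iff_eventually_exists {ι : Type u} {F : Filter ι} {Z : ι → Type*}
    [∀ i, Nonempty (Z i)] {V : Type*} {r : (∀ i, Z i) → V} (hr : Function.Surjective r)
    {p : V → Prop} {P : ∀ i, Z i → Prop} (hp : ∀ k, p (r k) ↔ ∀ᶠ i in F, P i (k i)) :
    (∃ y, p y) ↔ ∀ᶠ i in F, ∃ x, P i x := by
  simp only [hr.exists, hp]
  exact Filter.skolem.symm

theorem forall_iff_eventually_forall {ι : Type u} {U : Ultrafilter ι} {Z : ι → Type*}
    [∀ i, Nonempty (Z i)] {V : Type*} {r : (∀ i, Z i) → V} (hr : Function.Surjective r)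
    {p : V → Prop} {P : ∀ i, Z i → Prop} (hp : ∀ k, p (r k) ↔ ∀ᶠ i in U, P i (k i)) :
    (∀ y, p y) ↔ ∀ᶠ i in U, ∀ x, P i x := by
  have h := exists_iff_eventually_exists hr (p := fun y => ¬ p y) (P := fun i x => ¬ P i x)
    fun k => by rw [hp, Ultrafilter.eventually_not]
  rw [← not_iff_not, not_forall, h, ← Ultrafilter.eventually_not]
  simp only [not_forall]

theorem IsReducedProduct.tuple_eq_iff {ι : Type u} {F : Filter ι} {X : ι → Type u} {Y : Type u}
    {q : (∀ i, X i) → Y} (h : IsReducedProduct F q) {κ : Type*} [Finite κ]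
    (k k' : ∀ i, κ → X i) : tuple q k = tuple q k' ↔ ∀ᶠ i in F, k i = k' i := by
  simp only [funext_iff, tuple, h.eq_iff, Filter.eventually_all]

/-- The reduced product of a family of sets, as a quotient of the full product. -/
abbrev RProd {ι : Type u} (F : Filter ι) (X : ι → Type u) : Type u :=
  F.Product X

namespace RProd

variable {ι : Type u} {F : Filter ι} {X : ι → Type u}

/-- The canonical projection from the full product. -/
def mk (F : Filter ι) (k : ∀ i, X i) : RProd F X := Quotient.mk _ k

theorem isReducedProduct_mk : IsReducedProduct F (mk F (X := X)) :=
  ⟨Quotient.mk_surjective, fun _ _ => Quotient.eq⟩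

/-- An arbitrary representing family of an element of the reduced product. -/
noncomputable def rep (x : RProd F X) : ∀ i, X i := Quotient.out x

theorem mk_rep (x : RProd F X) : mk F x.rep = x := Quotient.out_eq x

theorem rep_mk (k : ∀ i, X i) : ∀ᶠ i in F, (mk F k).rep i = k i :=
  (isReducedProduct_mk.eq_iff _ _).1 (mk_rep _)

theorem eventually_rep_mk (k : ∀ i, X i) (p : ∀ i, X i → Prop) :
    (∀ᶠ i in F, p i ((mk F k).rep i)) ↔ ∀ᶠ i in F, p i (k i) :=
  Filter.eventually_congr ((rep_mk k).mono fun _ h => by rw [h])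

theorem eventually_rep_tuple {κ : Type*} [Finite κ] (k : ∀ i, κ → X i)
    (p : ∀ i, (κ → X i) → Prop) :
    (∀ᶠ i in F, p i fun c => (tuple (mk F) k c).rep i) ↔ ∀ᶠ i in F, p i (k i) :=
  have h : ∀ᶠ i in F, (fun c => (tuple (mk F) k c).rep i) = k i := by
    simp only [funext_iff, Filter.eventually_all]
    exact fun c => rep_mk _
  Filter.eventually_congr (h.mono fun _ h => by rw [h])

end RProd

/-! ## Categories of relational structures -/

/-- A presentation of the objects of `C` as nonempty relational structures with sorts `σ`, of which
the morphisms of `C` are exactly the homomorphisms. The arguments of a symbol `a` are indexed by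
`arity a s` in the sort `s`, and `Holds M a` is its interpretation in `M`. Operations are presented
by their graphs. -/
structure RelPresentation (C : Type (u + 1)) [Category.{u} C] (σ : Type) where
  carrier (s : σ) : C ⥤ Type u
  nonempty (s : σ) (M : C) : Nonempty ((carrier s).obj M)
  Sym : Type u
  arity : Sym → σ → Type
  Holds (M : C) (a : Sym) (v : ∀ s, arity a s → (carrier s).obj M) : Prop
  holds_map {M N : C} (f : M ⟶ N) {a : Sym} {v : ∀ s, arity a s → (carrier s).obj M} :
    Holds M a v → Holds N a fun s c => (carrier s).map f (v s c)
  hom_ext {M N : C} {f g : M ⟶ N} : (∀ s x, (carrier s).map f x = (carrier s).map g x) → f = g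
  exists_hom {M N : C} (f : ∀ s, (carrier s).obj M → (carrier s).obj N) :
    (∀ a v, Holds M a v → Holds N a fun s c => f s (v s c)) →
      ∃ g : M ⟶ N, ∀ s x, (carrier s).map g x = f s x

namespace RelPresentation

variable {C : Type (u + 1)} [Category.{u} C] {σ : Type} (R : RelPresentation C σ)

theorem holds_map_iso {M N : C} (e : M ≅ N) {a : R.Sym}
    {v : ∀ s, R.arity a s → (R.carrier s).obj M} :
    R.Holds N a (fun s c => (R.carrier s).map e.hom (v s c)) ↔ R.Holds M a v := by
  refine ⟨fun h => ?_, R.holds_map e.hom⟩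
  simpa only [← Functor.map_comp_apply, Iso.hom_inv_id, Functor.map_id_apply] using
    R.holds_map e.inv h

/-- `P` with the projections `p` is the product of the structures `M j`, constructed as usual on
the product of the carriers. -/
structure IsProduct {κ : Type u} (M : κ → C) (P : C) (p : ∀ j, P ⟶ M j) : Prop where
  bijective (s : σ) :
    Function.Bijective fun (x : (R.carrier s).obj P) j => (R.carrier s).map (p j) x
  holds_iff (a : R.Sym) (v : ∀ s, R.arity a s → (R.carrier s).obj P) :
    R.Holds P a v ↔ ∀ j, R.Holds (M j) a fun s c => (R.carrier s).map (p j) (v s c)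

/-- `N` with the maps `q` is the reduced product of the structures `M i` modulo `F`: a symbol holds
at the classes of some families of elements if it holds at almost all of their members. -/
structure IsReducedProduct {ι : Type u} (F : Filter ι) (M : ι → C) (N : C)
    (q : ∀ s, (∀ i, (R.carrier s).obj (M i)) → (R.carrier s).obj N) : Prop where
  carrier (s : σ) : Strat.IsReducedProduct F (q s)
  holds_iff (a : R.Sym) (v : ∀ i s, R.arity a s → (R.carrier s).obj (M i)) :
    R.Holds N a (fun s => tuple (q s) fun i => v i s) ↔ ∀ᶠ i in F, R.Holds (M i) a (v i)

/-- The products and the reduced products of the structures of `C` are again in `C`. -/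
structure ClosedUnderReducedProducts : Prop where
  exists_isProduct {κ : Type u} (M : κ → C) : ∃ P p, R.IsProduct M P p
  exists_isReducedProduct {ι : Type u} (F : Filter ι) (M : ι → C) :
    ∃ N q, R.IsReducedProduct F M N q

variable {R}

theorem exists_isProduct_of_equiv {κ : Type u} {M : κ → C} {P : C}
    (e : ∀ s, (R.carrier s).obj P ≃ ∀ j, (R.carrier s).obj (M j))
    (he : ∀ a v, R.Holds P a v ↔ ∀ j, R.Holds (M j) a fun s c => e s (v s c) j) :
    ∃ p, R.IsProduct M P p := by
  choose p hp using fun j => R.exists_hom (fun s x => e s x j) fun a v hv => (he a v).1 hv j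
  refine ⟨p, ⟨fun s => ?_, fun a v => ?_⟩⟩
  · simpa only [hp] using (e s).bijective
  · simpa only [hp] using he a v

namespace IsProduct

variable {κ : Type u} {M : κ → C} {P : C} {p : ∀ j, P ⟶ M j}

theorem exists_lift (h : R.IsProduct M P p) {T : C} (g : ∀ j, T ⟶ M j) :
    ∃ f : T ⟶ P, ∀ j, f ≫ p j = g j := by
  choose f hf using fun s (x : (R.carrier s).obj T) =>
    (h.bijective s).surjective fun j => (R.carrier s).map (g j) x
  have hf (s x j) : (R.carrier s).map (p j) (f s x) = (R.carrier s).map (g j) x :=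
    congrFun (hf s x) j
  obtain ⟨f', hf'⟩ := R.exists_hom f fun a v hv => (h.holds_iff a _).2 fun j => by
    simpa only [hf] using R.holds_map (g j) hv
  exact ⟨f', fun j => R.hom_ext fun s x => by rw [Functor.map_comp_apply, hf', hf]⟩

theorem hom_ext (h : R.IsProduct M P p) {T : C} {f g : T ⟶ P} (hfg : ∀ j, f ≫ p j = g ≫ p j) :
    f = g :=
  R.hom_ext fun s x => (h.bijective s).injective <| funext fun j => by
    simp only [← Functor.map_comp_apply, hfg]

theorem nonempty_isLimit (h : R.IsProduct M P p) :
    Nonempty (Limits.IsLimit (Limits.Fan.mk P p)) := by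
  choose lift hlift using fun s : Limits.Fan M => h.exists_lift s.proj
  exact ⟨Limits.Fan.IsLimit.mk _ lift hlift fun s m hm =>
    h.hom_ext fun j => (hm j).trans (hlift s j).symm⟩

theorem of_iso (h : R.IsProduct M P p) {Q : C} (e : Q ≅ P) :
    R.IsProduct M Q fun j => e.hom ≫ p j where
  bijective s := by
    simp only [Functor.map_comp_apply]
    exact (h.bijective s).comp ((R.carrier s).mapIso e).toEquiv.bijective
  holds_iff a v := by
    simp only [Functor.map_comp_apply, ← h.holds_iff, R.holds_map_iso]

end IsProduct

theorem ClosedUnderReducedProducts.isProduct_of_isLimit (hR : R.ClosedUnderReducedProducts)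
    {κ : Type u} {M : κ → C} {P : C} {p : ∀ j, P ⟶ M j}
    (hP : Limits.IsLimit (Limits.Fan.mk P p)) : R.IsProduct M P p := by
  obtain ⟨P', p', h⟩ := hR.exists_isProduct M
  obtain ⟨hP'⟩ := h.nonempty_isLimit
  have hp : (fun j => (hP.conePointUniqueUpToIso hP').hom ≫ p' j) = p :=
    funext fun j => hP.conePointUniqueUpToIso_hom_comp hP' ⟨j⟩
  exact hp ▸ h.of_iso (hP.conePointUniqueUpToIso hP')

theorem IsReducedProduct.of_iso {ι : Type u} {F : Filter ι} {M : ι → C} {N : C}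
    {q : ∀ s, (∀ i, (R.carrier s).obj (M i)) → (R.carrier s).obj N}
    (h : R.IsReducedProduct F M N q) {N' : C} (e : N ≅ N') :
    R.IsReducedProduct F M N' fun s k => (R.carrier s).map e.hom (q s k) where
  carrier s :=
    have he := ((R.carrier s).mapIso e).toEquiv.bijective
    ⟨he.surjective.comp (h.carrier s).surjective,
      fun k k' => he.injective.eq_iff.trans ((h.carrier s).eq_iff k k')⟩
  holds_iff a v := (R.holds_map_iso e).trans (h.holds_iff a v)

end RelPresentation

/-! ## Filtered products of relational structures -/

namespace ProductSystem

variable {C : Type (u + 1)} [Category.{u} C] {ι : Type u} {F : Filter ι} {M : ι → C}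
  (A : ProductSystem F M)

theorem map_diagram_map_proj (H : C ⥤ Type u) {J J' : {J : Set ι // J ∈ F}ᵒᵖ} (f : J ⟶ J')
    (i : J'.unop.1) (x : H.obj (A.prod J.unop)) :
    H.map (A.proj J'.unop i) (H.map (A.diagram.map f) x)
      = H.map (A.proj J.unop ⟨i.1, leOfHom f.unop i.2⟩) x :=
  (H.map_comp_apply ..).symm.trans <|
    congrArg (fun g => H.map g x) (Limits.Fan.IsLimit.fac (A.isProd J'.unop) _ i)

/-- The element `x` of the product over `J` has the components `k i`, for `i ∈ J`. -/
def HasComponents (H : C ⥤ Type u) {J : {J : Set ι // J ∈ F}} (x : H.obj (A.prod J))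
    (k : ∀ i, H.obj (M i)) : Prop :=
  ∀ j : J.1, H.map (A.proj J j) x = k j

theorem exists_hasComponents {H : C ⥤ Type u} (hH : ∀ N, Nonempty (H.obj N))
    {J : {J : Set ι // J ∈ F}} (x : H.obj (A.prod J)) : ∃ k, A.HasComponents H x k :=
  have ⟨k, hk⟩ := Subtype.exists_pi_extension (ne := fun i => hH (M i)) fun j : J.1 =>
    H.map (A.proj J j) x
  ⟨k, fun j => (congrFun hk j).symm⟩

variable {A}

theorem HasComponents.map {H : C ⥤ Type u} {J J' : {J : Set ι // J ∈ F}ᵒᵖ}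
    {x : H.obj (A.prod J.unop)} {k : ∀ i, H.obj (M i)} (h : A.HasComponents H x k) (f : J ⟶ J') :
    A.HasComponents (J := J'.unop) H (H.map (A.diagram.map f) x) k :=
  fun j => (A.map_diagram_map_proj H f j x).trans (h ⟨j.1, leOfHom f.unop j.2⟩)

/-- The map `q` sends a family of elements of the factors to its class in the point of `c`. -/
structure IsClassMap (c : Limits.Cocone A.diagram) (H : C ⥤ Type u)
    (q : (∀ i, H.obj (M i)) → H.obj c.pt) : Prop where
  surjective : Function.Surjective q
  exists_hasComponents (J : {J : Set ι // J ∈ F}) (k : ∀ i, H.obj (M i)) :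
    ∃ x : H.obj (A.prod J), A.HasComponents H x k
  map_ι {J : {J : Set ι // J ∈ F}} {x : H.obj (A.prod J)} {k : ∀ i, H.obj (M i)} :
    A.HasComponents H x k → H.map (c.ι.app (op J)) x = q k

theorem IsClassMap.of_iso {c c' : Limits.Cocone A.diagram} {H : C ⥤ Type u}
    {q : (∀ i, H.obj (M i)) → H.obj c.pt} (h : IsClassMap c H q) (e : c ≅ c') :
    IsClassMap c' H fun k => H.map e.hom.hom (q k) where
  surjective := (H.mapIso ((Limits.Cocone.forget _).mapIso e)).toEquiv.surjective.comp h.surjective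
  exists_hasComponents := h.exists_hasComponents
  map_ι {_ x _} hx :=
    (congrArg (fun g => H.map g x) (e.hom.w _)).symm.trans <|
      (H.map_comp_apply ..).trans <| congrArg (H.map e.hom.hom) (h.map_ι hx)

end ProductSystem

namespace RelPresentation.IsReducedProduct

variable {C : Type (u + 1)} [Category.{u} C] {σ : Type} {R : RelPresentation C σ} {ι : Type u}
  {F : Filter ι} {M : ι → C} {A : ProductSystem F M} {N : C}
  {q : ∀ s, (∀ i, (R.carrier s).obj (M i)) → (R.carrier s).obj N}

theorem exists_incl (h : R.IsReducedProduct F M N q)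
    (hA : ∀ J, R.IsProduct _ (A.prod J) (A.proj J)) (J : {J : Set ι // J ∈ F}) :
    ∃ μ : A.prod J ⟶ N, ∀ s x k, A.HasComponents (R.carrier s) x k →
      (R.carrier s).map μ x = q s k := by
  choose κ hκ using fun s => A.exists_hasComponents (R.nonempty s) (J := J)
  obtain ⟨μ, hμ⟩ := R.exists_hom (M := A.prod J) (N := N) (fun s x => q s (κ s x)) fun a v hv =>
    (h.holds_iff a fun i s c => κ s (v s c) i).2 <| Filter.mem_of_superset J.2 fun i hi => by
      have hvi := ((hA J).holds_iff a v).1 hv ⟨i, hi⟩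
      simp only [hκ _ _ ⟨i, hi⟩] at hvi
      exact hvi
  refine ⟨μ, fun s x k hk => (hμ s x).trans <| ((h.carrier s).eq_iff _ _).2 ?_⟩
  exact Filter.mem_of_superset J.2 fun i hi => (hκ s x ⟨i, hi⟩).symm.trans (hk ⟨i, hi⟩)

theorem exists_cocone (h : R.IsReducedProduct F M N q)
    (hA : ∀ J, R.IsProduct _ (A.prod J) (A.proj J)) :
    ∃ ι : A.diagram ⟶ (Functor.const _).obj N,
      ∀ s, ProductSystem.IsClassMap ⟨N, ι⟩ (R.carrier s) (q s) := by
  choose μ hμ using h.exists_incl hA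
  refine ⟨{ app J := μ J.unop, naturality J J' f := R.hom_ext fun s x => ?_ },
    fun s => ⟨(h.carrier s).surjective, fun J k => ?_, hμ _ s _ _⟩⟩
  · obtain ⟨k, hk⟩ := A.exists_hasComponents (R.nonempty s) (J := J.unop) x
    refine (Functor.map_comp_apply ..).trans <| (hμ _ s _ k (hk.map f)).trans ?_
    exact (hμ _ s x k hk).symm.trans (congrArg (fun g => (R.carrier s).map g x)
      (Category.comp_id _).symm)
  · exact ((hA J).bijective s).surjective (fun j => k j) |>.imp fun x hx => congrFun hx

/-- Both elements have the same image over the smaller index set on which their components agree. -/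
theorem map_ι_eq_of_eq (h : R.IsReducedProduct F M N q)
    (hA : ∀ J, R.IsProduct _ (A.prod J) (A.proj J)) (t : Limits.Cocone A.diagram) {s : σ}
    {J J' : {J : Set ι // J ∈ F}} {x : (R.carrier s).obj (A.prod J)}
    {x' : (R.carrier s).obj (A.prod J')} {k k' : ∀ i, (R.carrier s).obj (M i)}
    (hx : A.HasComponents (R.carrier s) x k) (hx' : A.HasComponents (R.carrier s) x' k')
    (hkk' : q s k = q s k') :
    (R.carrier s).map (t.ι.app (op J)) x = (R.carrier s).map (t.ι.app (op J')) x' := by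
  have hK := Filter.inter_mem (Filter.inter_mem J.2 J'.2) (((h.carrier s).eq_iff _ _).1 hkk')
  let f : op J ⟶ op ⟨_, hK⟩ := Quiver.Hom.op (homOfLE fun i hi => hi.1.1)
  let f' : op J' ⟶ op ⟨_, hK⟩ := Quiver.Hom.op (homOfLE fun i hi => hi.1.2)
  have hff' : (R.carrier s).map (A.diagram.map f) x = (R.carrier s).map (A.diagram.map f') x' :=
    ((hA ⟨_, hK⟩).bijective s).injective <| funext fun j =>
      (hx.map f j).trans <| j.2.2.trans (hx'.map f' j).symm
  rw [← t.w f, ← t.w f']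
  exact (Functor.map_comp_apply ..).trans <|
    (congrArg _ hff').trans (Functor.map_comp_apply ..).symm

theorem exists_desc {c : Limits.Cocone A.diagram}
    {q : ∀ s, (∀ i, (R.carrier s).obj (M i)) → (R.carrier s).obj c.pt}
    (h : R.IsReducedProduct F M c.pt q) (hA : ∀ J, R.IsProduct _ (A.prod J) (A.proj J))
    (hc : ∀ s, ProductSystem.IsClassMap c (R.carrier s) (q s)) (t : Limits.Cocone A.diagram) :
    ∃ g : c.pt ⟶ t.pt, ∀ J, c.ι.app J ≫ g = t.ι.app J := by
  choose κ hκ using fun s => (h.carrier s).surjective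
  choose x hx using fun s y => (hc s).exists_hasComponents ⟨Set.univ, F.univ_mem⟩ (κ s y)
  have desc_eq {s J} {z : (R.carrier s).obj (A.prod J)} {k} (hz : A.HasComponents _ z k) :
      (R.carrier s).map (t.ι.app (op ⟨Set.univ, F.univ_mem⟩)) (x s (q s k))
        = (R.carrier s).map (t.ι.app (op J)) z :=
    h.map_ι_eq_of_eq hA t (hx s _) hz (hκ s _)
  obtain ⟨g, hg⟩ := R.exists_hom
    (fun s y => (R.carrier s).map (t.ι.app (op ⟨Set.univ, F.univ_mem⟩)) (x s y)) fun a v hv => by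
      have hv' : (fun s => tuple (q s) fun i c => κ s (v s c) i) = v :=
        funext fun s => funext fun c => hκ s _
      have hK : {i | R.Holds (M i) a fun s c => κ s (v s c) i} ∈ F :=
        (h.holds_iff a fun i s c => κ s (v s c) i).1 (hv'.symm ▸ hv)
      choose z hz using fun s c => (hc s).exists_hasComponents ⟨_, hK⟩ (κ s (v s c))
      have hzv : R.Holds (A.prod ⟨_, hK⟩) a z := ((hA _).holds_iff a z).2 fun j => by
        simpa only [hz _ _ j] using show R.Holds (M j) a _ from j.2
      have ht := R.holds_map (N := t.pt) (t.ι.app (op ⟨_, hK⟩)) hzv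
      simp only [← desc_eq (hz _ _), hκ] at ht
      exact ht
  refine ⟨g, fun J => R.hom_ext fun s z => ?_⟩
  obtain ⟨k, hk⟩ := A.exists_hasComponents (R.nonempty s) (J := J.unop) z
  refine (Functor.map_comp_apply ..).trans <| (hg s _).trans ?_
  have hι : (R.carrier s).map (c.ι.app J) z = q s k := (hc s).map_ι hk
  rw [hι]
  exact desc_eq hk

theorem nonempty_isColimit {c : Limits.Cocone A.diagram}
    {q : ∀ s, (∀ i, (R.carrier s).obj (M i)) → (R.carrier s).obj c.pt}
    (h : R.IsReducedProduct F M c.pt q) (hA : ∀ J, R.IsProduct _ (A.prod J) (A.proj J))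
    (hc : ∀ s, ProductSystem.IsClassMap c (R.carrier s) (q s)) :
    Nonempty (Limits.IsColimit c) := by
  choose desc hdesc using fun t => h.exists_desc hA hc t
  refine ⟨⟨desc, hdesc, fun t m hm => R.hom_ext fun s y => ?_⟩⟩
  obtain ⟨k, rfl⟩ := (hc s).surjective y
  obtain ⟨x, hx⟩ := (hc s).exists_hasComponents ⟨Set.univ, F.univ_mem⟩ k
  rw [← (hc s).map_ι hx]
  refine (Functor.map_comp_apply ..).symm.trans <|
    (congrArg (fun g => (R.carrier s).map g x) ?_).trans (Functor.map_comp_apply ..)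
  exact (hm _).trans (hdesc t _).symm

end RelPresentation.IsReducedProduct

namespace RelPresentation.ClosedUnderReducedProducts

variable {C : Type (u + 1)} [Category.{u} C] {σ : Type} {R : RelPresentation C σ} {ι : Type u}
  {F : Filter ι} {M : ι → C}

theorem nonempty_filteredProduct (hR : R.ClosedUnderReducedProducts) :
    Nonempty (FilteredProduct F M) := by
  choose P p hP using fun J : {J : Set ι // J ∈ F} => hR.exists_isProduct fun i : J.1 => M i
  let A : ProductSystem F M := ⟨P, p, fun J => (hP J).nonempty_isLimit.some⟩
  obtain ⟨N, q, hN⟩ := hR.exists_isReducedProduct F M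
  obtain ⟨ι, hι⟩ := hN.exists_cocone (A := A) hP
  exact ⟨⟨A, ⟨N, ι⟩, (hN.nonempty_isColimit hP hι).some⟩⟩

theorem exists_isClassMap (hR : R.ClosedUnderReducedProducts) (A : FilteredProduct F M) :
    ∃ q, R.IsReducedProduct F M A.cocone.pt q ∧
      ∀ s, ProductSystem.IsClassMap A.cocone (R.carrier s) (q s) := by
  have hA J := hR.isProduct_of_isLimit (A.isProd J)
  obtain ⟨N, q, hN⟩ := hR.exists_isReducedProduct F M
  obtain ⟨ι, hι⟩ := hN.exists_cocone hA
  let e := (hN.nonempty_isColimit (c := ⟨N, ι⟩) hA hι).some.uniqueUpToIso A.isColimit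
  exact ⟨_, hN.of_iso ((Limits.Cocone.forget _).mapIso e), fun s => (hι s).of_iso e⟩

end RelPresentation.ClosedUnderReducedProducts

/-! ## Compactness from ultraproducts -/

namespace Institution

variable {I : Institution.{u}}

theorem models_anti {S : I.Sign} {E E' : Set (I.Sen.obj S)} (h : E ⊆ E') :
    I.models E' ⊆ I.models E :=
  fun _ hM ρ hρ => hM ρ (h hρ)

theorem mCompact_of_exists_ultralimit
    (h : ∀ {S : I.Sign} {ι : Type u} (U : Ultrafilter ι) (M : ι → I.Mod.obj (op S)),
      ∃ N : I.Mod.obj (op S), ∀ ρ, (∀ᶠ i in U, I.Sat (M i) ρ) → I.Sat N ρ) : I.MCompact := by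
  classical
  refine fun S E => ⟨fun hE E₀ h₀ _ => hE.mono (models_anti h₀), fun hE => ?_⟩
  choose M hM using fun s : Finset E =>
    hE (Subtype.val '' (s : Set E)) (Subtype.coe_image_subset E s) (s.finite_toSet.image _)
  obtain ⟨N, hN⟩ := h (Ultrafilter.of Filter.atTop) M
  refine ⟨N, fun ρ hρ => hN ρ (Ultrafilter.of_le _ ?_)⟩
  exact (Filter.eventually_ge_atTop {⟨ρ, hρ⟩}).mono fun s hs =>
    hM s ρ ⟨_, hs (Finset.mem_singleton_self _), rfl⟩

theorem MCompact.compact (h : I.MCompact)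
    (hneg : ∀ {S : I.Sign} (ρ : I.Sen.obj S), ∃ ρ', ∀ M, I.Sat M ρ' ↔ ¬ I.Sat M ρ) :
    I.Compact := by
  intro S E ρ hE
  obtain ⟨ρ', hρ'⟩ := hneg ρ
  by_contra! hcon
  obtain ⟨M, hM⟩ := (h S (insert ρ' E)).2 fun E₀ h₀ hfin => by
    obtain ⟨M, hM, hMρ⟩ := Set.not_subset.1
      (hcon (E₀ \ {ρ'}) (Set.sdiff_singleton_subset_iff.2 h₀) hfin.sdiff)
    have hMρ' : I.Sat M ρ' := (hρ' M).2 fun hsat => hMρ fun _ hσ => hσ ▸ hsat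
    refine ⟨M, fun σ hσ => ?_⟩
    by_cases hs : σ = ρ'
    · exact hs ▸ hMρ'
    · exact hM σ ⟨hσ, hs⟩
  exact (hρ' M).1 (hM ρ' (Set.mem_insert _ _))
    (hE (models_anti (Set.subset_insert _ _) hM) ρ rfl)

end Institution

namespace StratInst

/-- `I` is a stratified institution with negation and ultraproducts in which Łoś's theorem holds:
the states of an ultraproduct are the classes of the families of states of the factors, and a
sentence holds at such a class if and only if it holds at almost all members of the family. -/
structure IsLos (I : StratInst.{u}) : Prop where
  nonempty {S : I.Sign} (M : I.Mod.obj (op S)) : Nonempty ((I.st S).obj M)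
  exists_neg {S : I.Sign} (ρ : I.Sen.obj S) :
    ∃ ρ', ∀ (M : I.Mod.obj (op S)) (w : (I.st S).obj M), I.Sat M w ρ' ↔ ¬ I.Sat M w ρ
  stSurjective : I.StSurjective
  hasUltraproducts : I.HasUltraproducts
  exists_los {S : I.Sign} {ι : Type u} {U : Ultrafilter ι} {M : ι → I.Mod.obj (op S)}
    (A : FilteredProduct (U : Filter ι) M) :
    ∃ q, ProductSystem.IsClassMap A.cocone (I.st S) q ∧
      ∀ k ρ, I.Sat A.cocone.pt (q k) ρ ↔ ∀ᶠ i in U, I.Sat (M i) (k i) ρ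

namespace IsLos

variable {I : StratInst.{u}}

theorem pullback (h : I.IsLos) {T : Type (u + 1)} [Category.{u} T] (Φ : T ⥤ I.Sign) :
    (I.pullback Φ).IsLos where
  nonempty {S} := h.nonempty (S := Φ.obj S)
  exists_neg {S} := h.exists_neg (S := Φ.obj S)
  stSurjective φ := h.stSurjective (Φ.map φ)
  hasUltraproducts S := h.hasUltraproducts (Φ.obj S)
  exists_los {S} := h.exists_los (S := Φ.obj S)

theorem sat_iff_factorSat (h : I.IsLos) {S : I.Sign} (ρ : I.Sen.obj S) {ι : Type u}
    {U : Ultrafilter ι} {M : ι → I.Mod.obj (op S)} (A : FilteredProduct (U : Filter ι) M)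
    (w : (I.st S).obj A.cocone.pt) : I.Sat A.cocone.pt w ρ ↔ I.FactorSat A w ρ := by
  obtain ⟨q, hq, hlos⟩ := h.exists_los A
  constructor
  · obtain ⟨k, rfl⟩ := hq.surjective w
    intro hk
    obtain ⟨x, hx⟩ := hq.exists_hasComponents ⟨_, (hlos k ρ).1 hk⟩ k
    exact ⟨_, x, hq.map_ι hx, fun j => (hx j).symm ▸ j.2⟩
  · rintro ⟨J, x, rfl, hsat⟩
    obtain ⟨k, hk⟩ := A.exists_hasComponents h.nonempty x
    simp only [hk _] at hsat
    rw [hq.map_ι hk, hlos]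
    exact Filter.mem_of_superset J.2 fun i hi => hsat ⟨i, hi⟩

theorem sharp_mCompact (h : I.IsLos) : I.sharp.MCompact :=
  Institution.mCompact_of_exists_ultralimit fun {S} _ U M => by
    obtain ⟨A⟩ := h.hasUltraproducts S _ U fun i => (M i).1
    obtain ⟨q, -, hlos⟩ := h.exists_los A
    exact ⟨⟨A.cocone.pt, q fun i => (M i).2⟩, fun ρ => (hlos _ ρ).2⟩

theorem star_mCompact (h : I.IsLos) : (I.star h.stSurjective).MCompact :=
  Institution.mCompact_of_exists_ultralimit fun {S} _ U M => by
    obtain ⟨A⟩ := h.hasUltraproducts S _ U M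
    obtain ⟨q, hq, hlos⟩ := h.exists_los A
    refine ⟨A.cocone.pt, fun ρ hρ => hq.surjective.forall.2 fun k => (hlos k ρ).2 ?_⟩
    exact hρ.mono fun i hi => hi (k i)

theorem sharp_compact (h : I.IsLos) : I.sharp.Compact :=
  h.sharp_mCompact.compact fun ρ =>
    have ⟨ρ', hρ'⟩ := h.exists_neg ρ
    ⟨ρ', fun M => hρ' M.1 M.2⟩

end IsLos

end StratInst

/-! ## Models as relational structures -/

namespace Frame

variable {S : FrameSig.{u}}

/-- The symbols of a frame, considered as a relational structure on its set of worlds. -/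
inductive Sym (S : FrameSig.{u}) : Type u
  | nom (i : S.Nom)
  | mdl {n : ℕ} (l : S.Mdl n)

/-- The type indexing the arguments of a symbol. -/
def Sym.arity : Sym S → Type
  | nom _ => Unit
  | mdl (n := n) _ => Fin n

/-- The interpretation of a symbol in a frame. -/
def Holds (M : Frame S) : (a : Sym S) → (a.arity → M.W) → Prop
  | .nom i, v => M.nom i = v ()
  | .mdl l, v => v ∈ M.rel l

theorem Hom.holds {M N : Frame S} (h : M ⟶ N) :
    ∀ {a : Sym S} {v : a.arity → M.W}, M.Holds a v → N.Holds a (h.toFun ∘ v)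
  | .nom i, _, hv => (h.map_nom i).symm.trans (congrArg h.toFun hv)
  | .mdl l, v, hv => h.map_rel l v hv

theorem exists_hom {M N : Frame S} (f : M.W → N.W)
    (hf : ∀ a v, M.Holds a v → N.Holds a (f ∘ v)) : ∃ h : M ⟶ N, h.toFun = f :=
  ⟨⟨f, fun i => (hf (.nom i) (fun _ => M.nom i) rfl).symm, fun l => hf (.mdl l)⟩, rfl⟩

/-- The product of a family of frames. -/
def pi {κ : Type u} (M : κ → Frame S) : Frame S where
  W := ∀ j, (M j).W
  ne := ⟨fun j => (M j).ne.some⟩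
  nom i j := (M j).nom i
  rel l := {v | ∀ j, (fun c => v c j) ∈ (M j).rel l}

theorem holds_pi {κ : Type u} {M : κ → Frame S} :
    ∀ {a : Sym S} {v : a.arity → ∀ j, (M j).W},
      (pi M).Holds a v ↔ ∀ j, (M j).Holds a fun c => v c j
  | .nom _, _ => funext_iff
  | .mdl _, _ => Iff.rfl

/-- The reduced product of a family of frames. -/
def rprod {ι : Type u} (F : Filter ι) (M : ι → Frame S) : Frame S where
  W := RProd F fun i => (M i).W
  ne := ⟨RProd.mk F fun i => (M i).ne.some⟩
  nom a := RProd.mk F fun i => (M i).nom a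
  rel l := {v | ∀ᶠ i in F, (fun c => (v c).rep i) ∈ (M i).rel l}

theorem holds_rprod {ι : Type u} {F : Filter ι} {M : ι → Frame S} :
    ∀ {a : Sym S} {v : ∀ i, a.arity → (M i).W},
      (rprod F M).Holds a (tuple (RProd.mk F) v) ↔ ∀ᶠ i in F, (M i).Holds a (v i)
  | .nom _, _ => RProd.isReducedProduct_mk.eq_iff _ _
  | .mdl l, v => RProd.eventually_rep_tuple (κ := Fin _) v fun i v => v ∈ (M i).rel l

end Frame

namespace FModel

variable {L : FOLSig.{u}}

/-- The symbols of a first-order structure, considered as a relational structure. -/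
inductive Sym (L : FOLSig.{u}) : Type u
  | fn {n : ℕ} (f : L.Functions n)
  | rel {n : ℕ} (r : L.Relations n)

/-- The type indexing the arguments of a symbol; the graph of an operation has one additional
argument, the value. -/
def Sym.arity : Sym L → Type
  | fn (n := n) _ => Option (Fin n)
  | rel (n := n) _ => Fin n

/-- The interpretation of a symbol in a first-order structure. -/
def Holds (M : FModel L) : (a : Sym L) → (a.arity → M.D) → Prop
  | .fn f, v => M.str.funMap f (v ∘ some) = v none
  | .rel r, v => M.str.RelMap r v

theorem holds_of_isFOHom {M N : FModel L} {h : M.D → N.D} (hh : IsFOHom M.str N.str h) :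
    ∀ {a : Sym L} {v : a.arity → M.D}, M.Holds a v → N.Holds a (h ∘ v)
  | .fn f, _, hv => (hh.map_fun f _).symm.trans (congrArg h hv)
  | .rel r, v, hv => hh.map_rel r v hv

theorem isFOHom {M N : FModel L} {h : M.D → N.D}
    (hh : ∀ a v, M.Holds a v → N.Holds a (h ∘ v)) : IsFOHom M.str N.str h where
  map_fun f x := (hh (.fn f) (fun c => c.elim (M.str.funMap f x) x) rfl).symm
  map_rel r := hh (.rel r)

/-- The product of a family of first-order structures. -/
def pi {κ : Type u} (M : κ → FModel L) : FModel L where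
  D := ∀ j, (M j).D
  ne := ⟨fun j => (M j).ne.some⟩
  str :=
    { funMap f x j := (M j).str.funMap f fun c => x c j
      RelMap r x := ∀ j, (M j).str.RelMap r fun c => x c j }

theorem holds_pi {κ : Type u} {M : κ → FModel L} :
    ∀ {a : Sym L} {v : a.arity → ∀ j, (M j).D},
      (pi M).Holds a v ↔ ∀ j, (M j).Holds a fun c => v c j
  | .fn _, _ => funext_iff
  | .rel _, _ => Iff.rfl

/-- The reduced product of a family of first-order structures. -/
noncomputable def rprod {ι : Type u} (F : Filter ι) (M : ι → FModel L) : FModel L where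
  D := RProd F fun i => (M i).D
  ne := ⟨RProd.mk F fun i => (M i).ne.some⟩
  str :=
    { funMap f x := RProd.mk F fun i => (M i).str.funMap f fun c => (x c).rep i
      RelMap r x := ∀ᶠ i in F, (M i).str.RelMap r fun c => (x c).rep i }

theorem holds_rprod {ι : Type u} {F : Filter ι} {M : ι → FModel L} :
    ∀ {a : Sym L} {v : ∀ i, a.arity → (M i).D},
      (rprod F M).Holds a (tuple (RProd.mk F) v) ↔ ∀ᶠ i in F, (M i).Holds a (v i)
  | .fn f, v => (RProd.isReducedProduct_mk.eq_iff _ _).trans <|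
      RProd.eventually_rep_tuple (fun i => v i ∘ some)
        fun i x => (M i).str.funMap f x = v i none
  | .rel r, v => RProd.eventually_rep_tuple (κ := Fin _) v fun i => (M i).str.RelMap r

/-- First-order structures as relational structures. -/
def presentation (L : FOLSig.{u}) : RelPresentation (FModel L) Unit where
  carrier _ := { obj M := M.D, map h := ↾h.toFun }
  nonempty _ M := M.ne
  Sym := Sym L
  arity a _ := a.arity
  Holds M a v := M.Holds a (v ())
  holds_map h _ _ := holds_of_isFOHom h.isHom
  hom_ext h := Hom.ext (funext (h ()))
  exists_hom f hf := ⟨⟨f (), isFOHom fun a v => hf a fun _ => v⟩, fun _ _ => rfl⟩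

theorem closedUnderReducedProducts : (presentation L).ClosedUnderReducedProducts where
  exists_isProduct M := ⟨pi M, RelPresentation.exists_isProduct_of_equiv (fun _ => Equiv.refl _)
    fun _ _ => holds_pi⟩
  exists_isReducedProduct F M := ⟨rprod F M, fun _ => RProd.mk F,
    { carrier _ := RProd.isReducedProduct_mk, holds_iff _ _ := holds_rprod }⟩

end FModel

namespace PModel

variable {S : PSig.{u}}

/-- The symbols of a propositional Kripke structure: those of its frame, and the propositional
variables as unary predicates of worlds. -/
abbrev Sym (S : PSig.{u}) : Type u := Frame.Sym S.1 ⊕ S.2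

/-- The type indexing the arguments of a symbol. -/
def Sym.arity : Sym S → Type
  | .inl a => a.arity
  | .inr _ => Unit

/-- The interpretation of a symbol in a propositional Kripke structure. -/
def Holds (M : PModel S) : (a : Sym S) → (a.arity → M.frame.W) → Prop
  | .inl a, v => M.frame.Holds a v
  | .inr p, v => p ∈ M.val (v ())

theorem Hom.holds {M N : PModel S} (h : M ⟶ N) :
    ∀ {a : Sym S} {v : a.arity → M.frame.W}, M.Holds a v → N.Holds a (h.frame.toFun ∘ v)
  | .inl _, _, hv => Frame.Hom.holds h.frame hv
  | .inr _, _, hv => h.map_val _ hv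

theorem exists_hom {M N : PModel S} (f : M.frame.W → N.frame.W)
    (hf : ∀ a v, M.Holds a v → N.Holds a (f ∘ v)) : ∃ h : M ⟶ N, h.frame.toFun = f :=
  have ⟨h, hh⟩ := Frame.exists_hom f fun a => hf (.inl a)
  ⟨⟨h, fun w p => hh ▸ hf (.inr p) fun _ => w⟩, hh⟩

/-- The product of a family of propositional Kripke structures. -/
def pi {κ : Type u} (M : κ → PModel S) : PModel S where
  frame := Frame.pi fun j => (M j).frame
  val w := {p | ∀ j, p ∈ (M j).val (w j)}

theorem holds_pi {κ : Type u} {M : κ → PModel S} :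
    ∀ {a : Sym S} {v : a.arity → ∀ j, (M j).frame.W},
      (pi M).Holds a v ↔ ∀ j, (M j).Holds a fun c => v c j
  | .inl _, _ => Frame.holds_pi
  | .inr _, _ => Iff.rfl

/-- The reduced product of a family of propositional Kripke structures. -/
def rprod {ι : Type u} (F : Filter ι) (M : ι → PModel S) : PModel S where
  frame := Frame.rprod F fun i => (M i).frame
  val w := {p | ∀ᶠ i in F, p ∈ (M i).val (RProd.rep w i)}

theorem holds_rprod {ι : Type u} {F : Filter ι} {M : ι → PModel S} :
    ∀ {a : Sym S} {v : ∀ i, a.arity → (M i).frame.W},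
      (rprod F M).Holds a (tuple (RProd.mk F) v) ↔ ∀ᶠ i in F, (M i).Holds a (v i)
  | .inl _, _ => Frame.holds_rprod
  | .inr p, v => RProd.eventually_rep_mk (fun i => v i ()) fun i w => p ∈ (M i).val w

/-- Propositional Kripke structures as relational structures on their sets of worlds. -/
def presentation (S : PSig.{u}) : RelPresentation (PModel S) Unit where
  carrier _ := { obj M := M.frame.W, map h := ↾h.frame.toFun }
  nonempty _ M := M.frame.ne
  Sym := Sym S
  arity a _ := a.arity
  Holds M a v := M.Holds a (v ())
  holds_map h _ _ := Hom.holds h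
  hom_ext h := Hom.ext (Frame.Hom.ext (funext (h ())))
  exists_hom f hf :=
    have ⟨h, hh⟩ := exists_hom (f ()) fun a v => hf a fun _ => v
    ⟨h, fun _ => congrFun hh⟩

theorem closedUnderReducedProducts : (presentation S).ClosedUnderReducedProducts where
  exists_isProduct M := ⟨pi M, RelPresentation.exists_isProduct_of_equiv (fun _ => Equiv.refl _)
    fun _ _ => holds_pi⟩
  exists_isReducedProduct F M := ⟨rprod F M, fun _ => RProd.mk F,
    { carrier _ := RProd.isReducedProduct_mk, holds_iff _ _ := holds_rprod }⟩

end PModel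

/-- The sorts of the two-layered models: upper worlds, and elements of the common carrier of the
structures at these worlds. -/
inductive Layer
  | outer
  | inner

namespace QModel

variable {S : QSig.{u}}

/-- The first-order structure at a world. -/
def loc (M : QModel S) (w : M.frame.W) : FModel S.2 where
  D := M.D
  ne := M.ne
  str := M.str w

/-- The symbols of a first-order Kripke structure: those of its frame, and those of the structures
at its worlds. -/
abbrev Sym (S : QSig.{u}) : Type u := Frame.Sym S.1 ⊕ FModel.Sym S.2

/-- The type indexing the arguments of a symbol. A symbol of the structures at the worlds has a
world as an additional argument. -/
def Sym.arity : Sym S → Layer → Type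
  | .inl a, .outer => a.arity
  | .inl _, .inner => Empty
  | .inr _, .outer => Unit
  | .inr a, .inner => a.arity

/-- The carrier functors of first-order Kripke structures. -/
def carrier : Layer → QModel S ⥤ Type u
  | .outer => { obj M := M.frame.W, map h := ↾h.frame.toFun }
  | .inner => { obj M := M.D, map h := ↾h.toFun }

/-- The interpretation of a symbol in a first-order Kripke structure. -/
def Holds (M : QModel S) : (a : Sym S) → (∀ s, a.arity s → (carrier s).obj M) → Prop
  | .inl a, v => M.frame.Holds a (v .outer)
  | .inr a, v => (M.loc (v .outer ())).Holds a (v .inner)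

theorem Hom.holds {M N : QModel S} (h : M ⟶ N) :
    ∀ {a : Sym S} {v : ∀ s, a.arity s → (carrier s).obj M},
      M.Holds a v → N.Holds a fun s c => (carrier s).map h (v s c)
  | .inl _, _, hv => Frame.Hom.holds h.frame hv
  | .inr _, _, hv => FModel.holds_of_isFOHom (h.isHom _) hv

theorem exists_hom {M N : QModel S} (f : ∀ s, (carrier s).obj M → (carrier s).obj N)
    (hf : ∀ a v, M.Holds a v → N.Holds a fun s c => f s (v s c)) :
    ∃ h : M ⟶ N, h.frame.toFun = f .outer ∧ h.toFun = f .inner := by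
  obtain ⟨h, hh⟩ := Frame.exists_hom (f .outer) fun a v => hf (.inl a)
    fun | .outer => v | .inner => Empty.elim
  refine ⟨⟨h, f .inner, fun w => ?_⟩, hh, rfl⟩
  rw [hh]
  exact FModel.isFOHom (M := M.loc w) (N := N.loc (f .outer w)) fun a v => hf (.inr a)
    fun | .outer => fun _ => w | .inner => v

/-- The product of a family of first-order Kripke structures. -/
def pi {κ : Type u} (M : κ → QModel S) : QModel S where
  frame := Frame.pi fun j => (M j).frame
  D := ∀ j, (M j).D
  ne := ⟨fun j => (M j).ne.some⟩
  str w := (FModel.pi fun j => (M j).loc (w j)).str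
  rigid w w' c _ := funext fun j => (M j).rigid (w j) (w' j) c _

/-- The elements of the product, as families of elements of the factors. -/
def piEquiv {κ : Type u} (M : κ → QModel S) :
    ∀ s, (carrier s).obj (pi M) ≃ ∀ j, (carrier s).obj (M j)
  | .outer => Equiv.refl _
  | .inner => Equiv.refl _

theorem holds_pi {κ : Type u} {M : κ → QModel S} :
    ∀ {a : Sym S} {v : ∀ s, a.arity s → (carrier s).obj (pi M)},
      (pi M).Holds a v ↔ ∀ j, (M j).Holds a fun s c => piEquiv M s (v s c) j
  | .inl _, _ => Frame.holds_pi
  | .inr _, v => FModel.holds_pi (M := fun j => (M j).loc (v .outer () j))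

/-- The reduced product of a family of first-order Kripke structures. -/
noncomputable def rprod {ι : Type u} (F : Filter ι) (M : ι → QModel S) : QModel S where
  frame := Frame.rprod F fun i => (M i).frame
  D := RProd F fun i => (M i).D
  ne := ⟨RProd.mk F fun i => (M i).ne.some⟩
  str w := (FModel.rprod F fun i => (M i).loc (RProd.rep w i)).str
  rigid w w' c _ := congrArg (RProd.mk F) <| funext fun i =>
    (M i).rigid (RProd.rep w i) (RProd.rep w' i) c _

/-- The classes of families of worlds and of families of elements. -/
def rprodMk {ι : Type u} (F : Filter ι) (M : ι → QModel S) :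
    ∀ s, (∀ i, (carrier s).obj (M i)) → (carrier s).obj (rprod F M)
  | .outer => RProd.mk F
  | .inner => RProd.mk F

theorem holds_rprod {ι : Type u} {F : Filter ι} {M : ι → QModel S} :
    ∀ {a : Sym S} {v : ∀ i s, a.arity s → (carrier s).obj (M i)},
      (rprod F M).Holds a (fun s => tuple (rprodMk F M s) fun i => v i s)
        ↔ ∀ᶠ i in F, (M i).Holds a (v i)
  | .inl _, _ => Frame.holds_rprod
  | .inr a, v => FModel.holds_rprod.trans <|
      RProd.eventually_rep_mk (fun i => v i .outer ())
        fun i w => ((M i).loc w).Holds a (v i .inner)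

/-- First-order Kripke structures as two-sorted relational structures. -/
def presentation (S : QSig.{u}) : RelPresentation (QModel S) Layer where
  carrier := carrier
  nonempty
    | .outer, M => M.frame.ne
    | .inner, M => M.ne
  Sym := Sym S
  arity := Sym.arity
  Holds := Holds
  holds_map h _ _ := Hom.holds h
  hom_ext h := Hom.ext (Frame.Hom.ext (funext (h .outer))) (funext (h .inner))
  exists_hom f hf :=
    have ⟨h, h₀, h₁⟩ := exists_hom f hf
    ⟨h, fun | .outer => congrFun h₀ | .inner => congrFun h₁⟩

theorem closedUnderReducedProducts : (presentation S).ClosedUnderReducedProducts where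
  exists_isProduct M := ⟨pi M, RelPresentation.exists_isProduct_of_equiv (piEquiv M)
    fun _ _ => holds_pi⟩
  exists_isReducedProduct F M := ⟨rprod F M, rprodMk F M,
    { carrier := fun | .outer => RProd.isReducedProduct_mk | .inner => RProd.isReducedProduct_mk
      holds_iff _ _ := holds_rprod }⟩

end QModel

namespace HHModel

variable {S : HHSig.{u}}

/-- The symbols of a two-layered Kripke structure: those of its upper frame, and those of the
structures at its upper worlds. -/
abbrev Sym (S : HHSig.{u}) : Type u :=
  Frame.Sym (HHSig.upper.obj S) ⊕ PModel.Sym (HHSig.lower.obj S)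

/-- The type indexing the arguments of a symbol. A symbol of the structures at the upper worlds has
an upper world as an additional argument. -/
def Sym.arity : Sym S → Layer → Type
  | .inl a, .outer => a.arity
  | .inl _, .inner => Empty
  | .inr _, .outer => Unit
  | .inr a, .inner => PModel.Sym.arity a

/-- The carrier functors of two-layered Kripke structures. -/
def carrier : Layer → HHModel S ⥤ Type u
  | .outer => { obj M := M.frame.W, map h := ↾h.frame.toFun }
  | .inner => { obj M := M.W₀, map h := ↾h.toFun }

/-- The interpretation of a symbol in a two-layered Kripke structure. -/
def Holds (M : HHModel S) : (a : Sym S) → (∀ s, a.arity s → (carrier s).obj M) → Prop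
  | .inl a, v => M.frame.Holds a (v .outer)
  | .inr a, v => (M.loc (v .outer ())).Holds a (v .inner)

theorem Hom.holds_loc {M N : HHModel S} (h : M ⟶ N) (w : M.frame.W)
    {a : PModel.Sym (HHSig.lower.obj S)} {v : a.arity → M.W₀} (hv : (M.loc w).Holds a v) :
    (N.loc (h.frame.toFun w)).Holds a (h.toFun ∘ v) := by
  obtain ⟨g, hg⟩ := h.isHom w
  exact hg ▸ PModel.Hom.holds g hv

theorem Hom.holds {M N : HHModel S} (h : M ⟶ N) :
    ∀ {a : Sym S} {v : ∀ s, a.arity s → (carrier s).obj M},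
      M.Holds a v → N.Holds a fun s c => (carrier s).map h (v s c)
  | .inl _, _, hv => Frame.Hom.holds h.frame hv
  | .inr _, _, hv => h.holds_loc _ hv

theorem exists_hom {M N : HHModel S} (f : ∀ s, (carrier s).obj M → (carrier s).obj N)
    (hf : ∀ a v, M.Holds a v → N.Holds a fun s c => f s (v s c)) :
    ∃ h : M ⟶ N, h.frame.toFun = f .outer ∧ h.toFun = f .inner := by
  obtain ⟨h, hh⟩ := Frame.exists_hom (f .outer) fun a v => hf (.inl a)
    fun | .outer => v | .inner => Empty.elim
  refine ⟨⟨h, f .inner, fun w => ?_⟩, hh, rfl⟩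
  rw [hh]
  exact PModel.exists_hom (M := M.loc w) (N := N.loc (f .outer w)) (f .inner) fun a v =>
    hf (.inr a) fun | .outer => fun _ => w | .inner => v

/-- The product of a family of two-layered Kripke structures. -/
def pi {κ : Type u} (M : κ → HHModel S) : HHModel S where
  frame := Frame.pi fun j => (M j).frame
  W₀ := ∀ j, (M j).W₀
  ne := ⟨fun j => (M j).ne.some⟩
  nom₀ i j := (M j).nom₀ i
  rel₀ w := (PModel.pi fun j => (M j).loc (w j)).frame.rel
  val w := (PModel.pi fun j => (M j).loc (w j)).val

/-- The elements of the product, as families of elements of the factors. -/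
def piEquiv {κ : Type u} (M : κ → HHModel S) :
    ∀ s, (carrier s).obj (pi M) ≃ ∀ j, (carrier s).obj (M j)
  | .outer => Equiv.refl _
  | .inner => Equiv.refl _

theorem holds_pi {κ : Type u} {M : κ → HHModel S} :
    ∀ {a : Sym S} {v : ∀ s, a.arity s → (carrier s).obj (pi M)},
      (pi M).Holds a v ↔ ∀ j, (M j).Holds a fun s c => piEquiv M s (v s c) j
  | .inl _, _ => Frame.holds_pi
  | .inr _, v => PModel.holds_pi (M := fun j => (M j).loc (v .outer () j))

/-- The reduced product of a family of two-layered Kripke structures. -/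
def rprod {ι : Type u} (F : Filter ι) (M : ι → HHModel S) : HHModel S where
  frame := Frame.rprod F fun i => (M i).frame
  W₀ := RProd F fun i => (M i).W₀
  ne := ⟨RProd.mk F fun i => (M i).ne.some⟩
  nom₀ a := RProd.mk F fun i => (M i).nom₀ a
  rel₀ w := (PModel.rprod F fun i => (M i).loc (RProd.rep w i)).frame.rel
  val w := (PModel.rprod F fun i => (M i).loc (RProd.rep w i)).val

/-- The classes of families of upper worlds and of families of lower worlds. -/
def rprodMk {ι : Type u} (F : Filter ι) (M : ι → HHModel S) :
    ∀ s, (∀ i, (carrier s).obj (M i)) → (carrier s).obj (rprod F M)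
  | .outer => RProd.mk F
  | .inner => RProd.mk F

theorem holds_rprod {ι : Type u} {F : Filter ι} {M : ι → HHModel S} :
    ∀ {a : Sym S} {v : ∀ i s, a.arity s → (carrier s).obj (M i)},
      (rprod F M).Holds a (fun s => tuple (rprodMk F M s) fun i => v i s)
        ↔ ∀ᶠ i in F, (M i).Holds a (v i)
  | .inl _, _ => Frame.holds_rprod
  | .inr a, v => PModel.holds_rprod.trans <|
      RProd.eventually_rep_mk (fun i => v i .outer ())
        fun i w => ((M i).loc w).Holds a (v i .inner)

/-- Two-layered Kripke structures as two-sorted relational structures. -/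
def presentation (S : HHSig.{u}) : RelPresentation (HHModel S) Layer where
  carrier := carrier
  nonempty
    | .outer, M => M.frame.ne
    | .inner, M => M.ne
  Sym := Sym S
  arity := Sym.arity
  Holds := Holds
  holds_map h _ _ := Hom.holds h
  hom_ext h := Hom.ext (Frame.Hom.ext (funext (h .outer))) (funext (h .inner))
  exists_hom f hf :=
    have ⟨h, h₀, h₁⟩ := exists_hom f hf
    ⟨h, fun | .outer => congrFun h₀ | .inner => congrFun h₁⟩

theorem closedUnderReducedProducts : (presentation S).ClosedUnderReducedProducts where
  exists_isProduct M := ⟨pi M, RelPresentation.exists_isProduct_of_equiv (piEquiv M)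
    fun _ _ => holds_pi⟩
  exists_isReducedProduct F M := ⟨rprod F M, rprodMk F M,
    { carrier := fun | .outer => RProd.isReducedProduct_mk | .inner => RProd.isReducedProduct_mk
      holds_iff _ _ := holds_rprod }⟩

end HHModel

/-! ## Łoś's theorem -/

attribute [instance] Frame.ne FModel.ne QModel.ne HHModel.ne

namespace Frame

variable {S : FrameSig.{u}} {ι : Type u} {F : Filter ι} {M : ι → Frame S} {N : Frame S}
  {q : (∀ i, (M i).W) → N.W}

/-- `q` exhibits `N` as the reduced product of the frames `M i` modulo `F`. -/
structure IsReducedProduct (F : Filter ι) (M : ι → Frame S) (N : Frame S)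
    (q : (∀ i, (M i).W) → N.W) : Prop extends Strat.IsReducedProduct F q where
  holds_iff (a : Sym S) (v : ∀ i, a.arity → (M i).W) :
    N.Holds a (tuple q v) ↔ ∀ᶠ i in F, (M i).Holds a (v i)

namespace IsReducedProduct

theorem nom_eq (h : IsReducedProduct F M N q) (a : S.Nom) : N.nom a = q fun i => (M i).nom a :=
  (h.holds_iff (.nom a) fun i _ => (M i).nom a).2 (.of_forall fun _ => rfl)

theorem mem_rel_iff (h : IsReducedProduct F M N q) {n : ℕ} (l : S.Mdl n)
    (v : ∀ i, Fin n → (M i).W) : tuple q v ∈ N.rel l ↔ ∀ᶠ i in F, v i ∈ (M i).rel l :=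
  h.holds_iff (.mdl l) v

theorem elim_nom_eq (h : IsReducedProduct F M N q) {k : ℕ} (v : ∀ i, Fin k → (M i).W)
    (a : S.Nom ⊕ Fin k) :
    Sum.elim N.nom (tuple q v) a = q fun i => Sum.elim (M i).nom (v i) a := by
  cases a with
  | inl a => exact h.nom_eq a
  | inr c => rfl

theorem exists_mem_rel_iff (h : IsReducedProduct F M N q) {n : ℕ} (l : S.Mdl (n + 1))
    (w : ∀ i, (M i).W) {p : Fin n → N.W → Prop} {P : ∀ i, Fin n → (M i).W → Prop}
    (hp : ∀ c k, p c (q k) ↔ ∀ᶠ i in F, P i c (k i)) :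
    (∃ u : Fin n → N.W, (Fin.cons (q w) u : Fin (n + 1) → N.W) ∈ N.rel l ∧ ∀ c, p c (u c)) ↔
      ∀ᶠ i in F, ∃ u : Fin n → (M i).W,
        (Fin.cons (w i) u : Fin (n + 1) → (M i).W) ∈ (M i).rel l ∧ ∀ c, P i c (u c) := by
  refine exists_iff_eventually_exists (tuple_surjective h.surjective _) fun u => ?_
  rw [tuple_cons, h.mem_rel_iff, Filter.eventually_and, Filter.eventually_all]
  exact and_congr Iff.rfl (forall_congr' fun c => hp c fun i => u i c)

end IsReducedProduct

end Frame

theorem PModel.isReducedProduct_frame {S : PSig.{u}} {ι : Type u} {F : Filter ι}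
    {M : ι → PModel S} {N : PModel S} {q : (∀ i, (M i).frame.W) → N.frame.W}
    (h : (PModel.presentation S).IsReducedProduct F M N fun _ => q) :
    Frame.IsReducedProduct F (fun i => (M i).frame) N.frame q where
  toIsReducedProduct := h.carrier ()
  holds_iff a v := h.holds_iff (.inl a) fun i _ => v i

theorem PForm.sat_iff_eventually {hyb : Bool} {S : PSig.{u}} {ι : Type u} {U : Ultrafilter ι}
    {M : ι → PModel S} {N : PModel S} {q : (∀ i, (M i).frame.W) → N.frame.W}
    (h : (PModel.presentation S).IsReducedProduct U M N fun _ => q) {k : ℕ}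
    (ρ : PForm hyb S.1 S.2 k) (v : ∀ i, Fin k → (M i).frame.W) (w : ∀ i, (M i).frame.W) :
    Sat N ρ (tuple q v) (q w) ↔ ∀ᶠ i in U, Sat (M i) ρ (v i) (w i) := by
  have hW := PModel.isReducedProduct_frame h
  induction ρ generalizing w with
  | atom p => exact h.holds_iff (.inr p) fun i _ _ => w i
  | and ρ σ ihρ ihσ => simp only [Sat, Filter.eventually_and, ihρ, ihσ]
  | neg ρ ih => simp only [Sat, Ultrafilter.eventually_not, ih]
  | poss l ρ ih => exact hW.exists_mem_rel_iff l w fun c => ih c v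
  | nom _ a => simp only [Sat, hW.elim_nom_eq, hW.eq_iff]
  | sat _ a ρ ih => simp only [Sat, hW.elim_nom_eq, ih]
  | exNom _ ρ ih =>
    refine exists_iff_eventually_exists hW.surjective fun a => ?_
    rw [tuple_snoc]
    exact ih _ w

theorem PForm.sat_elim0_iff_eventually {hyb : Bool} {S : PSig.{u}} {ι : Type u}
    {U : Ultrafilter ι} {M : ι → PModel S} {N : PModel S} {q : (∀ i, (M i).frame.W) → N.frame.W}
    (h : (PModel.presentation S).IsReducedProduct U M N fun _ => q) (ρ : PForm hyb S.1 S.2 0)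
    (w : ∀ i, (M i).frame.W) :
    Sat N ρ Fin.elim0 (q w) ↔ ∀ᶠ i in U, Sat (M i) ρ Fin.elim0 (w i) := by
  rw [← sat_iff_eventually h, tuple_elim0]

namespace FModel

variable {L : FOLSig.{u}} {ι : Type u} {F : Filter ι} {M : ι → FModel L} {N : FModel L}
  {q : (∀ i, (M i).D) → N.D}

theorem funMap_tuple (h : (presentation L).IsReducedProduct F M N fun _ => q) {n : ℕ}
    (f : L.Functions n) (x : ∀ i, Fin n → (M i).D) :
    N.str.funMap f (tuple q x) = q fun i => (M i).str.funMap f (x i) :=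
  (h.holds_iff (.fn f) fun i _ c => c.elim ((M i).str.funMap f (x i)) (x i)).2
    (.of_forall fun _ => rfl)

theorem relMap_tuple (h : (presentation L).IsReducedProduct F M N fun _ => q) {n : ℕ}
    (r : L.Relations n) (x : ∀ i, Fin n → (M i).D) :
    N.str.RelMap r (tuple q x) ↔ ∀ᶠ i in F, (M i).str.RelMap r (x i) :=
  h.holds_iff (.rel r) fun i _ => x i

theorem realize_tuple (h : (presentation L).IsReducedProduct F M N fun _ => q) {α : Type*}
    (t : L.Term α) (v : ∀ i, α → (M i).D) :
    @Language.Term.realize L N.D N.str α (tuple q v) t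
      = q fun i => @Language.Term.realize L (M i).D (M i).str α (v i) t := by
  induction t with
  | var => rfl
  | func f t ih =>
    simp only [Language.Term.realize, ih]
    exact funMap_tuple h f _

theorem relMap_realize_tuple (h : (presentation L).IsReducedProduct F M N fun _ => q) {α : Type*}
    {n : ℕ} (r : L.Relations n) (t : Fin n → L.Term α) (v : ∀ i, α → (M i).D) :
    (N.str.RelMap r fun j => @Language.Term.realize L N.D N.str α (tuple q v) (t j)) ↔
      ∀ᶠ i in F, (M i).str.RelMap r fun j =>
        @Language.Term.realize L (M i).D (M i).str α (v i) (t j) := by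
  simp only [realize_tuple h]
  exact relMap_tuple h r _

theorem elim_const_eq (h : (presentation L).IsReducedProduct F M N fun _ => q) {k : ℕ}
    (v : ∀ i, Fin k → (M i).D) (a : L.Functions 0 ⊕ Fin k) :
    Sum.elim (fun a => N.str.funMap a Fin.elim0) (tuple q v) a
      = q fun i => Sum.elim (fun a => (M i).str.funMap a Fin.elim0) (v i) a := by
  cases a with
  | inl a => rw [Sum.elim_inl, ← tuple_elim0 q fun _ => Fin.elim0, funMap_tuple h]; rfl
  | inr c => rfl

theorem mem_powRel_iff (h : (presentation L).IsReducedProduct F M N fun _ => q) {X : Type u}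
    [Finite X] {n : ℕ} (r : L.Relations n) (y : ∀ i, Fin n → X → (M i).D) :
    tuple (tuple q) y ∈ N.powRel X r ↔ ∀ᶠ i in F, y i ∈ (M i).powRel X r := by
  simp only [powRel, Set.mem_ofPred_eq, Filter.eventually_all]
  exact forall_congr' fun x => relMap_tuple h r fun i c => y i c x

theorem exists_mem_powRel_iff (h : (presentation L).IsReducedProduct F M N fun _ => q)
    {X : Type u} [Finite X] {n : ℕ} (r : L.Relations (n + 1)) (w : ∀ i, X → (M i).D)
    {p : Fin n → (X → N.D) → Prop} {P : ∀ i, Fin n → (X → (M i).D) → Prop}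
    (hp : ∀ c k, p c (tuple q k) ↔ ∀ᶠ i in F, P i c (k i)) :
    (∃ u : Fin n → X → N.D,
        (Fin.cons (tuple q w) u : Fin (n + 1) → X → N.D) ∈ N.powRel X r ∧ ∀ c, p c (u c)) ↔
      ∀ᶠ i in F, ∃ u : Fin n → X → (M i).D,
        (Fin.cons (w i) u : Fin (n + 1) → X → (M i).D) ∈ (M i).powRel X r ∧
          ∀ c, P i c (u c) := by
  have hq : Function.Surjective (tuple q (κ := X)) := tuple_surjective (h.carrier ()).surjective X
  refine exists_iff_eventually_exists (tuple_surjective hq _) fun u => ?_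
  rw [tuple_cons, mem_powRel_iff h, Filter.eventually_and, Filter.eventually_all]
  exact and_congr Iff.rfl (forall_congr' fun c => hp c fun i => u i c)

end FModel

namespace QModel

variable {S : QSig.{u}} {ι : Type u} {F : Filter ι} {M : ι → QModel S} {N : QModel S}
  {q : ∀ s, (∀ i, (carrier s).obj (M i)) → (carrier s).obj N}

theorem isReducedProduct_frame (h : (presentation S).IsReducedProduct F M N q) :
    Frame.IsReducedProduct F (fun i => (M i).frame) N.frame (q .outer) where
  toIsReducedProduct := h.carrier .outer
  holds_iff a v := h.holds_iff (.inl a) fun i => fun | .outer => v i | .inner => Empty.elim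

theorem isReducedProduct_loc (h : (presentation S).IsReducedProduct F M N q)
    (w : ∀ i, (M i).frame.W) :
    (FModel.presentation S.2).IsReducedProduct F (fun i => (M i).loc (w i))
      (N.loc (q .outer w)) fun _ => q .inner where
  carrier _ := h.carrier .inner
  holds_iff a v := h.holds_iff (.inr a) fun i => fun | .outer => fun _ => w i | .inner => v i ()

end QModel

theorem QForm.sat_iff_eventually {hyb : Bool} {S : QSig.{u}} {ι : Type u} {U : Ultrafilter ι}
    {M : ι → QModel S} {N : QModel S} {q : (∀ i, (M i).frame.W) → N.frame.W}
    {q' : (∀ i, (M i).D) → N.D}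
    (hW : Frame.IsReducedProduct U (fun i => (M i).frame) N.frame q)
    (hD : ∀ w, (FModel.presentation S.2).IsReducedProduct U (fun i => (M i).loc (w i))
      (N.loc (q w)) fun _ => q')
    {k m : ℕ} (ρ : QForm hyb S.1 S.2 k m) (v : ∀ i, Fin k → (M i).frame.W)
    (x : ∀ i, Fin m → (M i).D) (w : ∀ i, (M i).frame.W) :
    Sat N ρ (tuple q v) (tuple q' x) (q w) ↔ ∀ᶠ i in U, Sat (M i) ρ (v i) (x i) (w i) := by
  have hq' : Function.Surjective q' := ((hD fun i => (M i).frame.ne.some).carrier ()).surjective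
  induction ρ generalizing w with
  | atom r t => exact FModel.relMap_realize_tuple (hD w) r t x
  | and ρ σ ihρ ihσ => simp only [Sat, Filter.eventually_and, ihρ, ihσ]
  | neg ρ ih => simp only [Sat, Ultrafilter.eventually_not, ih]
  | ex ρ ih =>
    refine exists_iff_eventually_exists hq' fun a => ?_
    rw [tuple_snoc]
    exact ih v _ w
  | poss l ρ ih => exact hW.exists_mem_rel_iff l w fun c => ih c v x
  | nom _ a => simp only [Sat, hW.elim_nom_eq, hW.eq_iff]
  | sat _ a ρ ih => simp only [Sat, hW.elim_nom_eq, ih]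
  | exNom _ ρ ih =>
    refine exists_iff_eventually_exists hW.surjective fun a => ?_
    rw [tuple_snoc]
    exact ih _ x w

theorem QForm.sat_elim0_iff_eventually {hyb : Bool} {S : QSig.{u}} {ι : Type u}
    {U : Ultrafilter ι} {M : ι → QModel S} {N : QModel S}
    {q : (∀ i, (M i).frame.W) → N.frame.W} {q' : (∀ i, (M i).D) → N.D}
    (hW : Frame.IsReducedProduct U (fun i => (M i).frame) N.frame q)
    (hD : ∀ w, (FModel.presentation S.2).IsReducedProduct U (fun i => (M i).loc (w i))
      (N.loc (q w)) fun _ => q')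
    (ρ : QForm hyb S.1 S.2 0 0) (w : ∀ i, (M i).frame.W) :
    Sat N ρ Fin.elim0 Fin.elim0 (q w) ↔ ∀ᶠ i in U, Sat (M i) ρ Fin.elim0 Fin.elim0 (w i) := by
  rw [← sat_iff_eventually hW hD, tuple_elim0, tuple_elim0]

theorem OForm.sat_iff_eventually {hyb modal : Bool} {L : FOLSig.{u}} {X : Type u} [Finite X]
    {ι : Type u} {U : Ultrafilter ι} {M : ι → FModel L} {N : FModel L}
    {q : (∀ i, (M i).D) → N.D} (h : (FModel.presentation L).IsReducedProduct U M N fun _ => q)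
    {k : ℕ} (ρ : OForm hyb modal L X k) (v : ∀ i, Fin k → (M i).D) (w : ∀ i, X → (M i).D) :
    Sat N ρ (tuple q v) (tuple q w) ↔ ∀ᶠ i in U, Sat (M i) ρ (v i) (w i) := by
  have hq : IsReducedProduct U q := h.carrier ()
  induction ρ generalizing w with
  | atom r t =>
    simp only [Sat, tuple_sumElim]
    exact FModel.relMap_realize_tuple h r t _
  | and ρ σ ihρ ihσ => simp only [Sat, Filter.eventually_and, ihρ, ihσ]
  | neg ρ ih => simp only [Sat, Ultrafilter.eventually_not, ih]
  | ex ρ ih =>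
    refine exists_iff_eventually_exists hq.surjective fun a => ?_
    rw [tuple_snoc]
    exact ih _ w
  | poss _ r ρ ih => exact FModel.exists_mem_powRel_iff h r w fun c => ih c v
  | nom _ a =>
    simp only [Sat, FModel.elim_const_eq h]
    exact hq.tuple_eq_iff (fun i _ => _) w
  | sat _ a ρ ih =>
    simp only [Sat, FModel.elim_const_eq h]
    exact ih v fun i _ => _

theorem OForm.sat_elim0_iff_eventually {hyb modal : Bool} {L : FOLSig.{u}} {X : Type u} [Finite X]
    {ι : Type u} {U : Ultrafilter ι} {M : ι → FModel L} {N : FModel L}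
    {q : (∀ i, (M i).D) → N.D} (h : (FModel.presentation L).IsReducedProduct U M N fun _ => q)
    (ρ : OForm hyb modal L X 0) (w : ∀ i, X → (M i).D) :
    Sat N ρ Fin.elim0 (tuple q w) ↔ ∀ᶠ i in U, Sat (M i) ρ Fin.elim0 (w i) := by
  rw [← sat_iff_eventually h, tuple_elim0]

namespace HHModel

variable {S : HHSig.{u}} {ι : Type u} {F : Filter ι} {M : ι → HHModel S} {N : HHModel S}
  {q : ∀ s, (∀ i, (carrier s).obj (M i)) → (carrier s).obj N}

theorem isReducedProduct_frame (h : (presentation S).IsReducedProduct F M N q) :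
    Frame.IsReducedProduct F (fun i => (M i).frame) N.frame (q .outer) where
  toIsReducedProduct := h.carrier .outer
  holds_iff a v := h.holds_iff (.inl a) fun i => fun | .outer => v i | .inner => Empty.elim

theorem isReducedProduct_loc (h : (presentation S).IsReducedProduct F M N q)
    (w : ∀ i, (M i).frame.W) :
    (PModel.presentation (HHSig.lower.obj S)).IsReducedProduct F (fun i => (M i).loc (w i))
      (N.loc (q .outer w)) fun _ => q .inner where
  carrier _ := h.carrier .inner
  holds_iff a v := h.holds_iff (.inr a) fun i => fun | .outer => fun _ => w i | .inner => v i ()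

end HHModel

theorem HHForm.sat_iff_eventually {S : HHSig.{u}} {ι : Type u} {U : Ultrafilter ι}
    {M : ι → HHModel S} {N : HHModel S} {q : (∀ i, (M i).frame.W) → N.frame.W}
    {q' : (∀ i, (M i).W₀) → N.W₀}
    (hW : Frame.IsReducedProduct U (fun i => (M i).frame) N.frame q)
    (hloc : ∀ w, (PModel.presentation (HHSig.lower.obj S)).IsReducedProduct U
      (fun i => (M i).loc (w i)) (N.loc (q w)) fun _ => q')
    {j k : ℕ} (ρ : HHForm S j k) (x : ∀ i, Fin j → (M i).W₀) (v : ∀ i, Fin k → (M i).frame.W)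
    (w : ∀ i, (M i).frame.W) :
    Sat N ρ (tuple q' x) (tuple q v) (q w) ↔ ∀ᶠ i in U, Sat (M i) ρ (x i) (v i) (w i) := by
  have hq' : Function.Surjective q' := ((hloc fun i => (M i).frame.ne.some).carrier ()).surjective
  induction ρ generalizing w with
  | base ρ => exact forall_iff_eventually_forall hq' (PForm.sat_iff_eventually (hloc w) ρ x)
  | and ρ σ ihρ ihσ => simp only [Sat, Filter.eventually_and, ihρ, ihσ]
  | neg ρ ih => simp only [Sat, Ultrafilter.eventually_not, ih]
  | dia ρ ih =>
    refine exists_iff_eventually_exists hW.surjective fun u => ?_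
    rw [Filter.eventually_and, tuple_pair]
    exact and_congr (hW.mem_rel_iff Dia.dia _) (ih x v u)
  | nom a =>
    exact (iff_of_eq (congrArg (· = _) (hW.elim_nom_eq v a))).trans (hW.eq_iff _ _)
  | sat a ρ ih =>
    exact (iff_of_eq (congrArg (Sat N ρ _ _) (hW.elim_nom_eq v a))).trans (ih x v _)
  | exNom₁ ρ ih =>
    refine exists_iff_eventually_exists hW.surjective fun a => ?_
    rw [tuple_snoc]
    exact ih x _ w
  | exNom₀ ρ ih =>
    refine exists_iff_eventually_exists hq' fun a => ?_
    rw [tuple_snoc]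
    exact ih _ v w

theorem HHForm.sat_elim0_iff_eventually {S : HHSig.{u}} {ι : Type u} {U : Ultrafilter ι}
    {M : ι → HHModel S} {N : HHModel S} {q : (∀ i, (M i).frame.W) → N.frame.W}
    {q' : (∀ i, (M i).W₀) → N.W₀}
    (hW : Frame.IsReducedProduct U (fun i => (M i).frame) N.frame q)
    (hloc : ∀ w, (PModel.presentation (HHSig.lower.obj S)).IsReducedProduct U
      (fun i => (M i).loc (w i)) (N.loc (q w)) fun _ => q')
    (ρ : HHForm S 0 0) (w : ∀ i, (M i).frame.W) :
    Sat N ρ Fin.elim0 Fin.elim0 (q w) ↔ ∀ᶠ i in U, Sat (M i) ρ Fin.elim0 Fin.elim0 (w i) := by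
  rw [← sat_iff_eventually hW hloc, tuple_elim0, tuple_elim0]

/-! ## The benchmark logics -/

theorem kripkeProp_isLos (hyb : Bool) : (kripkeProp.{u} hyb).IsLos where
  nonempty M := M.frame.ne
  exists_neg ρ := ⟨.neg ρ, fun _ _ => Iff.rfl⟩
  stSurjective _ _ w := ⟨w, rfl⟩
  hasUltraproducts _ _ _ _ := PModel.closedUnderReducedProducts.nonempty_filteredProduct
  exists_los A := by
    obtain ⟨q, h, hq⟩ := PModel.closedUnderReducedProducts.exists_isClassMap A
    exact ⟨q (), hq (), fun w ρ => PForm.sat_elim0_iff_eventually (q := q ()) h ρ w⟩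

theorem kripkeFO_isLos (hyb : Bool) : (kripkeFO.{u} hyb).IsLos where
  nonempty M := M.frame.ne
  exists_neg ρ := ⟨.neg ρ, fun _ _ => Iff.rfl⟩
  stSurjective _ _ w := ⟨w, rfl⟩
  hasUltraproducts _ _ _ _ := QModel.closedUnderReducedProducts.nonempty_filteredProduct
  exists_los A := by
    obtain ⟨q, h, hq⟩ := QModel.closedUnderReducedProducts.exists_isClassMap A
    exact ⟨q .outer, hq .outer, fun w ρ => QForm.sat_elim0_iff_eventually
      (QModel.isReducedProduct_frame h) (QModel.isReducedProduct_loc h) ρ w⟩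

theorem hhpl_isLos : hhpl.{u}.IsLos where
  nonempty M := M.frame.ne
  exists_neg ρ := ⟨.neg ρ, fun _ _ => Iff.rfl⟩
  stSurjective _ _ w := ⟨w, rfl⟩
  hasUltraproducts _ _ _ _ := HHModel.closedUnderReducedProducts.nonempty_filteredProduct
  exists_los A := by
    obtain ⟨q, h, hq⟩ := HHModel.closedUnderReducedProducts.exists_isClassMap A
    exact ⟨q .outer, hq .outer, fun w ρ => HHForm.sat_elim0_iff_eventually
      (HHModel.isReducedProduct_frame h) (HHModel.isReducedProduct_loc h) ρ w⟩

theorem OSig.onVar_injective {V : Type u} {hyb modal : Bool} {S T : OSig V hyb modal} (φ : S ⟶ T) :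
    Function.Injective (onVar φ) :=
  fun _ _ h => Subtype.ext (congrArg (fun y : T.X => y.1) h)

theorem openFO_isLos (V : Type u) (hyb modal : Bool) : (openFO V hyb modal).IsLos where
  nonempty M := ⟨fun _ => M.ne.some⟩
  exists_neg ρ := ⟨.neg ρ, fun _ _ => Iff.rfl⟩
  stSurjective φ M w :=
    have : Nonempty (FModel.D M) := FModel.ne M
    (OSig.onVar_injective φ).surjective_comp_right (γ := FModel.D M) w
  hasUltraproducts _ _ _ _ := FModel.closedUnderReducedProducts.nonempty_filteredProduct
  exists_los {S} _ _ _ A := by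
    obtain ⟨q, h, hq⟩ := FModel.closedUnderReducedProducts.exists_isClassMap A
    refine ⟨tuple (q ()) (κ := S.X), ⟨tuple_surjective (hq ()).surjective _, fun J k => ?_, ?_⟩,
      fun w ρ => ?_⟩
    · choose x hx using fun c => (hq ()).exists_hasComponents J fun i => k i c
      exact ⟨x, fun j => funext fun c => hx c j⟩
    · exact fun hx => funext fun c => (hq ()).map_ι fun j => congrFun (hx j) c
    · exact OForm.sat_elim0_iff_eventually (q := q ()) h ρ w

theorem Benchmark.inst_isLos (V : Type u) : ∀ b : Benchmark, (b.inst V).IsLos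
  | MPL | MMPL => (kripkeProp_isLos false).pullback _
  | HPL => (kripkeProp_isLos true).pullback _
  | MHPL => kripkeProp_isLos true
  | MFOL | MMFOL => (kripkeFO_isLos false).pullback _
  | HFOL => (kripkeFO_isLos true).pullback _
  | MHFOL => kripkeFO_isLos true
  | HHPL => hhpl_isLos
  | OFOL => openFO_isLos V false false
  | MOFOL => openFO_isLos V false true
  | HOFOL => openFO_isLos V true false
  | HMOFOL => openFO_isLos V true true

end Strat

theorem mainTheorem1 (V : Type u) (b : Strat.Benchmark) :
    (b.inst V).HasUltraproducts ∧
    (∀ (S : (b.inst V).Sign) (ρ : (b.inst V).Sen.obj S),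
      (b.inst V).PreservedByUltraproducts ρ ∧ (b.inst V).PreservedByUltrafactors ρ) ∧
    (b.inst V).sharp.MCompact ∧
    (∃ h : (b.inst V).StSurjective, ((b.inst V).star h).MCompact) ∧
    (b.inst V).sharp.Compact :=
  have h := b.inst_isLos V
  ⟨h.hasUltraproducts,
    fun _ ρ => ⟨fun _ _ _ A w => (h.sat_iff_factorSat ρ A w).2,
      fun _ _ _ A w => (h.sat_iff_factorSat ρ A w).1⟩,
    h.sharp_mCompact, ⟨h.stSurjective, h.star_mCompact⟩, h.sharp_compact⟩
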